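/- Let $N\ge 1$ and $t\ge 0$ and put $q=e^{-t/(2N)}$. Consider Dyson Brownian motion on $U(N)$ started from the identity, with eigenvalues $e^{ix_1(t)},\dots,e^{ix_N(t)}$, $-\pi<x_j(t)\le\pi$. At $t=0$ all angles are $0$. For $t>0$ the joint probability density of the angles on $(-\pi,\pi]^N$ is $$ p_t(x_1,\dots,x_N)=\frac{q^{-N(N^2-1)/12}}{(2\pi)^N\prod_{l=1}^N l!}\ \prod_{1\le j<k\le N}\sin\frac{x_k-x_j}{2}\ \det\Big[\Big(-2\frac{\partial}{\partial x_j}\Big)^{k-1}\theta_\kappa\big(\tfrac{x_j}{2};q\big)\Big]_{j,k=1,\dots,N}, $$ where $\kappa=2$ for $N$ even, $\kappa=3$ for $N$ odd, $\theta_2(z;q)=\sum_{n\in\mathbb Z}q^{(n-1/2)^2}e^{2iz(n-1/2)}$ and $\theta_3(z;q)=\sum_{n\in\mathbb Z}q^{n^2}e^{2izn}$. Let $\langle\cdot\rangle$ denote the average over the angles at time $t$, and define the spectral form factor $$ S_N(k;t)=\Big\langle\sum_{l,l'=1}^N e^{ik(x_l-x_{l'})}\Big\rangle-\Big\langle\sum_{l=1}^N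 e^{ikx_l}\Big\rangle\Big\langle\sum_{l=1}^N e^{-ikx_l}\Big\rangle . $$ Write ${}_2F_1(a,b;c;z)=\sum_n\frac{(a)_n(b)_n}{n!\,(c)_n}z^n$ and ${}_1F_1(a;c;z)=\sum_n\frac{(a)_n}{n!\,(c)_n}z^n$, where $(u)_n=u(u+1)\cdots(u+n-1)$ (all the series below terminate), and let $L_n^{(\alpha)}(x)=\sum_{i=0}^n(-1)^i\binom{n+\alpha}{n-i}\frac{x^i}{i!}$ be the Laguerre polynomials. **Proposition 5.2.** For all integers $N\ge1$, $k\ge 1$ and all real $t\ge0$, $$ \begin{aligned} S_N(k;t)&=\min(k,N)-q^{2k^2+2k(N-1)}\Big(\frac{(N-1+k)!}{(k-1)!\,(N-1)!}\Big)^2\int_0^\infty s\,e^{-s(N+k-1)}\Big({}_2F_1\big(1-N,1-k;-(k-1+N);q^{-2k}e^s\big)\Big)^2ds\\ &=\min(k,N)-q^{2k^2+2k(N-1)}(kN)^2\int_0^\infty s\,e^{-s(N+k-1)}\Big({}_2F_1\big(1-N,1-k;2;1-q^{-2k}e^s\big)\Big)^2ds . \end{aligned} $$ Consequently, for every fixed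 integer $k\ge1$ and real $t\ge0$, $$ \begin{aligned} \lim_{N\to\infty}S_N(k;t)&=k-e^{-tk}k^2\int_0^\infty s\,e^{-s}\big({}_1F_1(1-k;2;kt+s)\big)^2ds\\ &=k-e^{-tk}\int_0^\infty s\,e^{-s}\big(L_{k-1}^{(1)}(kt+s)\big)^2ds . \end{aligned} $$ All the integrals converge. -/

import Mathlib

/-!
Eigenvalue statistics of Dyson Brownian motion on `U(N)` started from the identity: the joint
density of the eigen-angles, ensemble averages, the spectral form factor, and the special functions
in which the latter is expressed. The Gauss function is Mathlib's `ordinaryHypergeometric`.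
-/

namespace DysonBM

open MeasureTheory

noncomputable section

/-- The Jacobi theta function `θ₂(z; q) = ∑_{n ∈ ℤ} q^((n - 1/2)^2) e^(2 i z (n - 1/2))`. -/
def theta2 (z : ℂ) (q : ℝ) : ℂ :=
  ∑' n : ℤ, ((q ^ (((n : ℝ) - 1 / 2) ^ 2) : ℝ) : ℂ) *
    Complex.exp (2 * Complex.I * z * ((n : ℂ) - 1 / 2))

/-- The Jacobi theta function `θ₃(z; q) = ∑_{n ∈ ℤ} q^(n^2) e^(2 i z n)`. -/
def theta3 (z : ℂ) (q : ℝ) : ℂ :=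
  ∑' n : ℤ, ((q ^ ((n : ℝ) ^ 2) : ℝ) : ℂ) * Complex.exp (2 * Complex.I * z * (n : ℂ))

/-- `θ_κ` with `κ = 2` for `N` even and `κ = 3` for `N` odd. -/
def thetaN (N : ℕ) (z : ℂ) (q : ℝ) : ℂ :=
  if Even N then theta2 z q else theta3 z q

/-- The nome `q = e^(-t / (2 N))`. -/
def nome (N : ℕ) (t : ℝ) : ℝ := Real.exp (-t / (2 * (N : ℝ)))

/-- The joint probability density at time `t > 0`, on `(-π, π]^N`, of the eigen-angles of Dyson
Brownian motion on `U(N)` started from the identity: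
`q^(-N(N²-1)/12) / ((2π)^N ∏_{l=1}^N l!) · ∏_{j<k} sin((x_k - x_j)/2)
  · det[(-2 ∂/∂x_j)^(k-1) θ_κ(x_j/2; q)]_{j,k=1,…,N}`.
The matrix index `k : Fin N` below counts from `0`, so it plays the role of `k - 1`. The values are
real, but are kept in `ℂ`, where the theta functions live. -/
def jointDensity (N : ℕ) (t : ℝ) (x : Fin N → ℝ) : ℂ :=
  ((nome N t ^ (-((N : ℝ) * ((N : ℝ) ^ 2 - 1) / 12)) /
      ((2 * Real.pi) ^ N * ∏ l ∈ Finset.Icc 1 N, (l.factorial : ℝ)) : ℝ) : ℂ) *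
    ((∏ j : Fin N, ∏ k ∈ Finset.Ioi j, Real.sin ((x k - x j) / 2) : ℝ) : ℂ) *
    Matrix.det (Matrix.of fun j k : Fin N =>
      (-2 : ℂ) ^ (k : ℕ) *
        iteratedDeriv (k : ℕ) (fun y : ℝ => thetaN N ((y : ℂ) / 2) (nome N t)) (x j))

/-- The ensemble average `⟨f⟩` over the eigen-angles at time `t ≥ 0`. At `t = 0` the matrix is
the identity, so that all angles vanish; for `t > 0` the average is taken with respect to the
joint density. -/
def average (N : ℕ) (t : ℝ) (f : (Fin N → ℝ) → ℂ) : ℂ :=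
  if t = 0 then f 0
  else ∫ x in Set.univ.pi (fun _ : Fin N => Set.Ioc (-Real.pi) Real.pi), f x * jointDensity N t x

/-- The spectral form factor
`S_N(k; t) = Cov(∑_l e^(i k x_l), ∑_l e^(-i k x_l))
  = ⟨∑_{l,l'} e^(i k (x_l - x_l'))⟩ - ⟨∑_l e^(i k x_l)⟩ ⟨∑_l e^(-i k x_l)⟩`. -/
def formFactor (N : ℕ) (k : ℤ) (t : ℝ) : ℂ :=
  average N t (fun x => ∑ l, ∑ l', Complex.exp (Complex.I * (k : ℂ) * ((x l : ℂ) - (x l' : ℂ)))) -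
    average N t (fun x => ∑ l, Complex.exp (Complex.I * (k : ℂ) * (x l : ℂ))) *
      average N t (fun x => ∑ l, Complex.exp (-(Complex.I * (k : ℂ) * (x l : ℂ))))

/-- Kummer's confluent hypergeometric function `₁F₁(a; c; x) = ∑_n (a)_n / ((c)_n n!) x^n`. -/
def kummer (a c x : ℝ) : ℝ :=
  ∑' n : ℕ, (ascPochhammer ℝ n).eval a / ((ascPochhammer ℝ n).eval c * (n.factorial : ℝ)) * x ^ n

/-- The Laguerre polynomial `L_n^(α)(x) = ∑_{i=0}^n (-1)^i binom(n + α, n - i) x^i / i!`, where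
`binom(n + α, n - i) = (α + i + 1)_{n - i} / (n - i)!`. -/
def laguerre (n : ℕ) (α x : ℝ) : ℝ :=
  ∑ i ∈ Finset.range (n + 1),
    (-1) ^ i * ((ascPochhammer ℝ (n - i)).eval (α + (i : ℝ) + 1) / ((n - i).factorial : ℝ)) *
      (x ^ i / (i.factorial : ℝ))

end

end DysonBM

/-!
The spectral form factor of Dyson Brownian motion on `U(N)`: evaluation of the moments of the joint
density by Fourier expansion, the integral representations, and the limit of large matrices.
-/

namespace DysonBM

open MeasureTheory Filter Topology

/-! ### Vandermonde determinants with shifted nodes -/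

/-! Everything reduces to finite sums of Vandermonde ratios. Up to powers of 2i, the sine product is
the determinant of the exponentials e^(i y_k x_j) with y_k = `level N k`, and the entries of the
theta determinant have explicit Fourier series. Integrating against e^(i m·x), m an integer vector,
keeps one Fourier mode per variable, and the two determinants recombine: by `average_cexp` the
result is the mean over relabellings of m of q^(∑((y_j+m_j)² - y_j²)) Δ(y+m)/Δ(y), with Δ the
Vandermonde determinant (`weight`).

The form factor needs only m = k e_l and m = k(e_l - e_l'). Moving two nodes differs from moving
each alone only in the factor of that pair, so the pair weight is the product of the two single
weights times 1 - k²/(y_l - y_l' + k)² (`weight_single_sub_single`). The 1 cancels against the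
product of first moments, and the degenerate pairs l' = l and l' = l + k contribute N - max(N-k, 0)
= min(k, N) (`weight_pair_eq`, `formFactor_eq_sub_sum`). There remains k² times a double sum with
denominators c²; since 1/c² = ∫ s e^(-cs) ds over s > 0, it is an integral of the square of one
polynomial (`integral_mul_exp_mul_sq`). The coefficients `hyperCoeff` are those of a terminating
₂F₁, and the second form is the connection formula z ↦ 1 - z, which comes down to the
Chu–Vandermonde identity.

For the limit, substituting s/N for s in the second form makes the argument 1 - e^((kt+s)/N); the
₂F₁ tends to a ₁F₁ term by term, and dominated convergence applies (`abs_scaledIntegrand_le`). At t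
= 0, where the average is evaluation at the origin, the moment formulas with q = 1 follow instead
from ∑_l Δ(y + c e_l) = N Δ(y). -/

theorem sum_det_updateRow_mul {n R : Type*} [Fintype n] [DecidableEq n] [CommRing R]
    (A U : Matrix n n R) :
    ∑ l, (A.updateRow l ((A * U) l)).det = U.trace * A.det := by
  -- Cramer's rule; summing over l then produces a trace, and cyclicity brings the adjugate next to
  -- A.
  have h : ∀ l, (A.updateRow l ((A * U) l)).det = (A * U * A.adjugate) l l := by
    intro l
    rw [← Matrix.cramer_transpose_apply, Matrix.cramer_eq_adjugate_mulVec, ← Matrix.adjugate_transpose,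
      Matrix.mul_apply, Matrix.mulVec, dotProduct]
    simp [mul_comm]
  simp_rw [h]
  change Matrix.trace (A * U * A.adjugate) = _
  rw [Matrix.trace_mul_comm, ← Matrix.mul_assoc, Matrix.adjugate_mul]
  simp [mul_comm]

/-- The averaged shift operator acts on the Vandermonde determinant as a scalar. -/
theorem sum_det_vandermonde_update_add {R : Type*} [CommRing R] {N : ℕ} (y : Fin N → R) (c : R) :
    ∑ l, (Matrix.vandermonde (Function.update y l (y l + c))).det =
      N * (Matrix.vandermonde y).det := by
  -- By the binomial theorem, shifting a node by c multiplies its Vandermonde row by this unipotent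
  -- matrix, whose trace is N.
  set U : Matrix (Fin N) (Fin N) R :=
    Matrix.of fun i j => c ^ ((j : ℕ) - i) * ((j : ℕ).choose i : R)
  have hU : U.trace = N := by simp [Matrix.trace, U]
  rw [← hU, ← sum_det_updateRow_mul]
  refine Finset.sum_congr rfl fun l _ => congrArg Matrix.det ?_
  ext i j
  by_cases h : i = l
  · subst h
    simp only [Matrix.vandermonde_apply, Function.update_self, Matrix.updateRow_self,
      Matrix.mul_apply, U, Matrix.of_apply]
    rw [add_pow, Fin.sum_univ_eq_sum_range
      (fun m => y i ^ m * (c ^ ((j : ℕ) - m) * ((j : ℕ).choose m : R)))]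
    simp_rw [← mul_assoc]
    refine Finset.sum_subset (by simp) fun x _ hx => ?_
    rw [Nat.choose_eq_zero_of_lt (by simpa using hx)]
    simp
  · simp [Matrix.vandermonde_apply, h]

theorem exists_det_vandermonde_update {R : Type*} [CommRing R] {N : ℕ} (y : Fin N → R) (l : Fin N) :
    ∃ r : R, ∀ z, (Matrix.vandermonde (Function.update y l z)).det =
      r * ∏ j ∈ Finset.univ.erase l, (z - y j) := by
  have key : ∀ v : Fin N → R, (Matrix.vandermonde v).det =
      ∏ i, ∏ j, if i < j then v j - v i else 1 := by
    intro v
    rw [Matrix.det_vandermonde]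
    refine Finset.prod_congr rfl fun i _ => ?_
    rw [← Finset.prod_filter]
    congr 1
    ext; simp
  refine ⟨(∏ j ∈ Finset.univ.erase l, if l < j then -1 else 1) *
    ∏ i ∈ Finset.univ.erase l, ∏ j ∈ Finset.univ.erase l, if i < j then y j - y i else 1,
    fun z => ?_⟩
  rw [key, ← Finset.mul_prod_erase Finset.univ (fun i => ∏ j, if i < j then
      Function.update y l z j - Function.update y l z i else 1) (Finset.mem_univ l),
    ← Finset.mul_prod_erase Finset.univ
      (fun j => if l < j then Function.update y l z j - Function.update y l z l else 1)
      (Finset.mem_univ l), if_neg (lt_irrefl l), one_mul]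
  have h2 : ∀ i ∈ Finset.univ.erase l, (∏ j, if i < j then
        Function.update y l z j - Function.update y l z i else 1) =
      (if i < l then z - y i else 1) *
        ∏ j ∈ Finset.univ.erase l, if i < j then y j - y i else 1 := by
    intro i hi
    have hi' : i ≠ l := by simpa using hi
    rw [← Finset.mul_prod_erase Finset.univ (fun j => if i < j then
      Function.update y l z j - Function.update y l z i else 1) (Finset.mem_univ l)]
    simp only [Function.update_self, Function.update_of_ne hi']
    congr 1
    refine Finset.prod_congr rfl fun j hj => ?_
    rw [Function.update_of_ne (by simpa using hj)]
  rw [Finset.prod_congr rfl h2, Finset.prod_mul_distrib, ← mul_assoc,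
    mul_right_comm (∏ j ∈ Finset.univ.erase l, if l < j then (-1 : R) else 1)]
  congr 1
  rw [← Finset.prod_mul_distrib, ← Finset.prod_mul_distrib]
  refine Finset.prod_congr rfl fun j hj => ?_
  have hj' : j ≠ l := by simpa using hj
  rw [Function.update_self, Function.update_of_ne hj']
  rcases lt_or_gt_of_ne hj' with h | h
  · simp [h, h.not_gt]
  · simp [h, h.not_gt]

/-- As a function of the node l the determinant is a fixed multiple of the product of differences to
the other nodes; the values at z and at `y l` are compared. The cross-multiplied form needs neither
division nor distinct nodes. -/
theorem det_vandermonde_update_mul {R : Type*} [CommRing R] {N : ℕ} (y : Fin N → R) (l : Fin N)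
    (z : R) :
    (Matrix.vandermonde (Function.update y l z)).det * ∏ j ∈ Finset.univ.erase l, (y l - y j) =
      (Matrix.vandermonde y).det * ∏ j ∈ Finset.univ.erase l, (z - y j) := by
  obtain ⟨r, hr⟩ := exists_det_vandermonde_update y l
  have h := hr (y l)
  rw [Function.update_eq_self] at h
  rw [hr z, h]
  ring

/-! ### Weights of exponentials -/

/-- The exponents `j - (N - 1) / 2`, `j = 0, …, N - 1`. -/
noncomputable def level (N : ℕ) (j : Fin N) : ℝ := (j : ℝ) - ((N : ℝ) - 1) / 2

/-- The contribution of the exponential `e^(i m·x)` to averages of symmetric functions. -/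
noncomputable def weight (N : ℕ) (q : ℝ) (m : Fin N → ℝ) : ℝ :=
  q ^ (∑ j, ((level N j + m j) ^ 2 - level N j ^ 2)) *
    ((Matrix.vandermonde (level N + m)).det / (Matrix.vandermonde (level N)).det)

theorem level_injective (N : ℕ) : Function.Injective (level N) := by
  intro i j h
  simpa [level, Fin.ext_iff] using h

theorem det_vandermonde_level_ne_zero (N : ℕ) : (Matrix.vandermonde (level N)).det ≠ 0 :=
  Matrix.det_vandermonde_ne_zero_iff.2 (level_injective N)

theorem prod_level_sub_ne_zero (N : ℕ) (l : Fin N) :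
    ∏ j ∈ Finset.univ.erase l, (level N l - level N j) ≠ 0 :=
  Finset.prod_ne_zero_iff.2 fun j hj => sub_ne_zero.2 fun h => by
    have := level_injective N h
    simp [this] at hj

theorem weight_single {N : ℕ} {q : ℝ} (c : ℝ) (l : Fin N) :
    weight N q (Pi.single l c) = q ^ (2 * c * level N l + c ^ 2) *
      ∏ j ∈ Finset.univ.erase l,
        ((level N l + c - level N j) / (level N l - level N j)) := by
  have e : level N + Pi.single l c = Function.update (level N) l (level N l + c) := by
    ext j
    by_cases h : j = l
    · subst h; simp
    · simp [h]
  rw [weight, e, Finset.prod_div_distrib]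
  congr 1
  · congr 1
    rw [Finset.sum_eq_single l]
    · simp; ring
    · intro j _ hj; simp [hj]
    · simp
  · rw [div_eq_div_iff (det_vandermonde_level_ne_zero N) (prod_level_sub_ne_zero N l),
      det_vandermonde_update_mul]
    ring

theorem weight_zero (N : ℕ) (q : ℝ) : weight N q 0 = 1 := by
  simp [weight, det_vandermonde_level_ne_zero]

/-- The shifted node lands on another one, so the Vandermonde determinant vanishes. -/
theorem weight_single_eq_zero {N : ℕ} {q c : ℝ} {l l' : Fin N} (hl : l ≠ l')
    (h : level N l' = level N l + c) : weight N q (Pi.single l c) = 0 := by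
  rw [weight_single, Finset.prod_eq_zero (i := l')]
  · simp
  · simp [hl.symm]
  · simp [h]

/-- Two opposite shifts which exchange two nodes. -/
theorem weight_single_sub_single_swap {N : ℕ} {q c : ℝ} {l l' : Fin N} (hl : l ≠ l')
    (h : level N l' = level N l + c) :
    weight N q (Pi.single l c - Pi.single l' c) = -1 := by
  have e : level N + (Pi.single l c - Pi.single l' c) = level N ∘ Equiv.swap l l' := by
    ext j
    by_cases h1 : j = l
    · subst h1; simp [hl, h]
    · by_cases h2 : j = l'
      · subst h2; simp [h1, h]
      · simp [h1, h2, Equiv.swap_apply_of_ne_of_ne]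
  have es : ∑ j, ((level N j + (Pi.single l c - Pi.single l' c : Fin N → ℝ) j) ^ 2 - level N j ^ 2)
      = 0 := by
    have : ∀ j, level N j + (Pi.single l c - Pi.single l' c : Fin N → ℝ) j =
        level N (Equiv.swap l l' j) := fun j => congrFun e j
    simp_rw [this]
    rw [Finset.sum_sub_distrib, Equiv.sum_comp (Equiv.swap l l') (fun j => level N j ^ 2), sub_self]
  have ed : (Matrix.vandermonde (level N ∘ Equiv.swap l l')).det =
      -(Matrix.vandermonde (level N)).det := by
    have := Matrix.det_permute (Equiv.swap l l') (Matrix.vandermonde (level N))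
    rw [Equiv.Perm.sign_swap hl] at this
    calc _ = ((Matrix.vandermonde (level N)).submatrix (Equiv.swap l l') id).det := rfl
      _ = _ := by simpa using this
  rw [weight, es, e, ed, neg_div, div_self (det_vandermonde_level_ne_zero N)]
  simp

/-- With d the difference of the two levels, the pair contributes (d + 2c)/d when both nodes move,
but ((d + c)/d)² in the product of single weights; the quotient is 1 - c²/(d + c)². All other
factors agree, and the exponents of q add up. -/
theorem weight_single_sub_single {N : ℕ} {q c : ℝ} (hq : 0 < q) {l l' : Fin N} (hl : l ≠ l')
    (h : level N l - level N l' + c ≠ 0) :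
    weight N q (Pi.single l c - Pi.single l' c) =
      weight N q (Pi.single l c) * weight N q (Pi.single l' (-c)) *
        (1 - c ^ 2 / (level N l - level N l' + c) ^ 2) := by
  set y := level N with hy
  -- The nodes are moved one after the other: `w` has only l moved.
  set w := Function.update y l (y l + c) with hw
  have e : y + (Pi.single l c - Pi.single l' c) = Function.update w l' (y l' - c) := by
    ext j
    by_cases h2 : j = l'
    · subst h2; simp [hl.symm]; ring
    · by_cases h1 : j = l
      · subst h1; simp [hl, hw]
      · simp [h1, h2, hw]
  have hwl : w l' = y l' := by simp [hw, hl.symm]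
  have hne : y l - y l' ≠ 0 := sub_ne_zero.2 fun h => hl (level_injective N h)
  have es : ∑ j, ((y j + (Pi.single l c - Pi.single l' c : Fin N → ℝ) j) ^ 2 - y j ^ 2) =
      (2 * c * y l + c ^ 2) + (2 * (-c) * y l' + (-c) ^ 2) := by
    have : ∀ j, ((y j + (Pi.single l c - Pi.single l' c : Fin N → ℝ) j) ^ 2 - y j ^ 2) =
        (Pi.single l (2 * c * y l + c ^ 2) : Fin N → ℝ) j +
        (Pi.single l' (2 * (-c) * y l' + (-c) ^ 2) : Fin N → ℝ) j := by
      intro j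
      by_cases h2 : j = l'
      · subst h2; simp [hl.symm]; ring
      · by_cases h1 : j = l
        · subst h1; simp [hl]; ring
        · simp [h1, h2]
    simp_rw [this]
    rw [Finset.sum_add_distrib]
    simp
  have h1 := det_vandermonde_update_mul w l' (y l' - c)
  have h2 := det_vandermonde_update_mul y l (y l + c)
  rw [hwl] at h1
  have hmem : l ∈ Finset.univ.erase l' := by simp [hl]
  have split : ∀ z : ℝ, ∏ j ∈ Finset.univ.erase l', (z - w j) =
      (z - (y l + c)) * ∏ j ∈ (Finset.univ.erase l').erase l, (z - y j) := by
    intro z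
    rw [← Finset.mul_prod_erase _ _ hmem]
    congr 1
    · simp [hw]
    · refine Finset.prod_congr rfl fun j hj => ?_
      have : j ≠ l := by simp at hj; exact hj.1
      simp [hw, this]
  have split' : ∀ z : ℝ, ∏ j ∈ Finset.univ.erase l', (z - y j) =
      (z - y l) * ∏ j ∈ (Finset.univ.erase l').erase l, (z - y j) := fun z => by
    rw [← Finset.mul_prod_erase _ _ hmem]
  rw [weight_single, weight_single, weight, ← hy, es, e, Real.rpow_add hq, Finset.prod_div_distrib,
    Finset.prod_div_distrib, split', split']
  rw [split, split] at h1
  have p1 := prod_level_sub_ne_zero N l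
  have p2 := prod_level_sub_ne_zero N l'
  rw [← hy] at p1 p2
  rw [split'] at p2
  have v0 := det_vandermonde_level_ne_zero N
  rw [← hy] at v0
  set P := ∏ j ∈ (Finset.univ.erase l').erase l, (y l' - y j)
  set P' := ∏ j ∈ (Finset.univ.erase l').erase l, (y l' - c - y j)
  have hP : P ≠ 0 := right_ne_zero_of_mul p2
  have hn' : y l' - y l ≠ 0 := left_ne_zero_of_mul p2
  have e1 : (Matrix.vandermonde (Function.update w l' (y l' - c))).det =
      (Matrix.vandermonde w).det * ((y l' - c - (y l + c)) * P') / ((y l' - (y l + c)) * P) := by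
    rw [eq_div_iff (mul_ne_zero (fun h0 => h (by linarith)) hP), h1]
  have e2 : (Matrix.vandermonde w).det = (Matrix.vandermonde y).det *
      (∏ j ∈ Finset.univ.erase l, (y l + c - y j)) / (∏ j ∈ Finset.univ.erase l, (y l - y j)) := by
    rw [eq_div_iff p1, h2]
  have hd : y l' - (y l + c) ≠ 0 := fun h0 => h (by linarith)
  rw [e1, e2]
  simp only [← sub_eq_add_neg]
  field_simp
  ring

/-! ### Theta functions -/

theorem summable_gauss_mul_abs_pow {q δ : ℝ} (hq : 0 < q) (hq1 : q < 1) (hδ : |δ| ≤ 1) (k : ℕ) :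
    Summable fun n : ℤ => q ^ (((n : ℝ) - δ) ^ 2) * |(n : ℝ) - δ| ^ k := by
  set τ := -Real.log q with hτ
  have hτ0 : 0 < τ := neg_pos.2 (Real.log_neg hq hq1)
  have hT : 0 < τ / Real.pi := div_pos hτ0 Real.pi_pos
  -- The comparison series is the one dominating Jacobi's theta function; the linear term 2|n|
  -- absorbs the shift, as (n - δ)² ≥ n² - 2|n|.
  have hs := fun j => summable_pow_mul_jacobiTheta₂_term_bound (τ / Real.pi) hT j
  refine Summable.of_nonneg_of_le (fun n => by positivity) (fun n => ?_)
    (((hs k).add (hs 0)).mul_left (2 ^ (k - 1)))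
  have h1 : q ^ (((n : ℝ) - δ) ^ 2) ≤
      Real.exp (-Real.pi * (τ / Real.pi * (n : ℝ) ^ 2 - 2 * (τ / Real.pi) * ((|n| : ℤ) : ℝ))) := by
    rw [Real.rpow_def_of_pos hq, Real.exp_le_exp]
    have e : -Real.pi * (τ / Real.pi * (n : ℝ) ^ 2 - 2 * (τ / Real.pi) * ((|n| : ℤ) : ℝ)) =
        -τ * ((n : ℝ) ^ 2 - 2 * |(n : ℝ)|) := by
      push_cast
      field_simp
    rw [e, show Real.log q = -τ by rw [hτ, neg_neg]]
    refine mul_le_mul_of_nonpos_left ?_ (by linarith)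
    have : (n : ℝ) * δ ≤ |(n : ℝ)| := by
      calc (n : ℝ) * δ ≤ |(n : ℝ) * δ| := le_abs_self _
        _ = |(n : ℝ)| * |δ| := abs_mul _ _
        _ ≤ |(n : ℝ)| := mul_le_of_le_one_right (abs_nonneg _) hδ
    nlinarith [sq_nonneg δ]
  have h2 : |(n : ℝ) - δ| ^ k ≤ 2 ^ (k - 1) * (((|n| : ℤ) : ℝ) ^ k + 1) := by
    calc |(n : ℝ) - δ| ^ k ≤ (|(n : ℝ)| + 1) ^ k := by
          gcongr
          exact (abs_sub _ _).trans (by linarith)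
      _ ≤ _ := by
          have := add_pow_le (abs_nonneg (n : ℝ)) zero_le_one k
          simpa using this
  calc _ ≤ Real.exp (-Real.pi * (τ / Real.pi * (n : ℝ) ^ 2 - 2 * (τ / Real.pi) * ((|n| : ℤ) : ℝ)))
        * (2 ^ (k - 1) * (((|n| : ℤ) : ℝ) ^ k + 1)) := by gcongr
    _ = _ := by ring

/-- The `k`-th derivative of `∑_n q^((n - δ)^2) e^(i (n - δ) x)`. -/
noncomputable def thetaDeriv (δ q : ℝ) (k : ℕ) (x : ℝ) : ℂ :=
  ∑' n : ℤ, ((q ^ (((n : ℝ) - δ) ^ 2) : ℝ) : ℂ) * (Complex.I * ((n : ℂ) - δ)) ^ k *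
    Complex.exp (Complex.I * ((n : ℂ) - δ) * x)

theorem norm_thetaDeriv_term {q : ℝ} (hq : 0 < q) (δ : ℝ) (k : ℕ) (x : ℝ) (n : ℤ) :
    ‖((q ^ (((n : ℝ) - δ) ^ 2) : ℝ) : ℂ) * (Complex.I * ((n : ℂ) - δ)) ^ k *
      Complex.exp (Complex.I * ((n : ℂ) - δ) * x)‖ =
      q ^ (((n : ℝ) - δ) ^ 2) * |(n : ℝ) - δ| ^ k := by
  have e : Complex.I * ((n : ℂ) - δ) * x = (((n : ℝ) - δ) * x : ℝ) * Complex.I := by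
    push_cast; ring
  have e2 : ((n : ℂ) - δ) = (((n : ℝ) - δ : ℝ) : ℂ) := by push_cast; rfl
  rw [norm_mul, norm_mul, norm_pow, norm_mul, e, Complex.norm_exp_ofReal_mul_I, e2,
    Complex.norm_real, Complex.norm_real, Complex.norm_I, Real.norm_of_nonneg (by positivity)]
  simp

/-- Termwise differentiation: the norm of each term is independent of x, so one summable bound
serves the whole line. -/
theorem hasDerivAt_thetaDeriv {q δ : ℝ} (hq : 0 < q) (hq1 : q < 1) (hδ : |δ| ≤ 1) (k : ℕ) (x : ℝ) :
    HasDerivAt (thetaDeriv δ q k) (thetaDeriv δ q (k + 1) x) x := by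
  refine hasDerivAt_tsum (summable_gauss_mul_abs_pow hq hq1 hδ (k + 1)) (fun n y => ?_)
    (fun n y => (norm_thetaDeriv_term hq δ (k + 1) y n).le) (y₀ := 0) ?_ x
  · have h : HasDerivAt (fun y : ℝ => Complex.I * ((n : ℂ) - δ) * (y : ℂ))
        (Complex.I * ((n : ℂ) - δ)) y := by
      simpa using (Complex.ofRealCLM.hasDerivAt (x := y)).const_mul (Complex.I * ((n : ℂ) - δ))
    refine ((h.cexp).const_mul
      (((q ^ (((n : ℝ) - δ) ^ 2) : ℝ) : ℂ) * (Complex.I * ((n : ℂ) - δ)) ^ k)).congr_deriv ?_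
    rw [pow_succ]; ring
  · refine Summable.of_norm ?_
    simp_rw [norm_thetaDeriv_term hq]
    exact summable_gauss_mul_abs_pow hq hq1 hδ k

theorem iteratedDeriv_thetaDeriv {q δ : ℝ} (hq : 0 < q) (hq1 : q < 1) (hδ : |δ| ≤ 1) (k : ℕ) :
    iteratedDeriv k (thetaDeriv δ q 0) = thetaDeriv δ q k := by
  induction k with
  | zero => simp
  | succ k ih =>
    rw [iteratedDeriv_succ, ih]
    exact funext fun x => (hasDerivAt_thetaDeriv hq hq1 hδ k x).deriv

theorem continuous_thetaDeriv {q δ : ℝ} (hq : 0 < q) (hq1 : q < 1) (hδ : |δ| ≤ 1) (k : ℕ) :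
    Continuous (thetaDeriv δ q k) :=
  continuous_iff_continuousAt.2 fun x => (hasDerivAt_thetaDeriv hq hq1 hδ k x).continuousAt

theorem integral_cexp_int_mul (n : ℤ) :
    ∫ x in Set.Ioc (-Real.pi) Real.pi, Complex.exp (Complex.I * n * (x : ℂ)) =
      if n = 0 then 2 * (Real.pi : ℂ) else 0 := by
  rw [← intervalIntegral.integral_of_le (by linarith [Real.pi_pos])]
  split_ifs with h
  · subst h
    simp; ring
  · have hc : Complex.I * n ≠ 0 := mul_ne_zero Complex.I_ne_zero (by exact_mod_cast h)
    rw [integral_exp_mul_complex hc]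
    have e : Complex.I * n * (Real.pi : ℝ) =
        Complex.I * n * (-Real.pi : ℝ) + n * (2 * Real.pi * Complex.I) := by
      push_cast; ring
    rw [e, Complex.exp_add, Complex.exp_int_mul_two_pi_mul_I]
    simp

/-- Since a lies in ℤ + δ, all frequencies in the product are integers, and orthogonality keeps only
n = -p, where n - δ = -a. -/
theorem integral_cexp_mul_thetaDeriv {q δ : ℝ} (hq : 0 < q) (hq1 : q < 1) (hδ : |δ| ≤ 1) (k : ℕ)
    {a : ℝ} {p : ℤ} (ha : a = p + δ) :
    ∫ x in Set.Ioc (-Real.pi) Real.pi,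
      Complex.exp (Complex.I * a * (x : ℂ)) * thetaDeriv δ q k x =
      2 * Real.pi * ((q ^ (a ^ 2) : ℝ) : ℂ) * (-(Complex.I * a)) ^ k := by
  have hterm : ∀ (n : ℤ) (x : ℝ), Complex.exp (Complex.I * a * (x : ℂ)) *
      (((q ^ (((n : ℝ) - δ) ^ 2) : ℝ) : ℂ) * (Complex.I * ((n : ℂ) - δ)) ^ k *
        Complex.exp (Complex.I * ((n : ℂ) - δ) * x)) =
      ((q ^ (((n : ℝ) - δ) ^ 2) : ℝ) : ℂ) * (Complex.I * ((n : ℂ) - δ)) ^ k *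
        Complex.exp (Complex.I * ((n + p : ℤ) : ℂ) * x) := by
    intro n x
    rw [mul_left_comm, ← Complex.exp_add, ha]
    congr 2
    push_cast; ring
  have hnorm : ∀ (n : ℤ) (x : ℝ), ‖((q ^ (((n : ℝ) - δ) ^ 2) : ℝ) : ℂ) *
      (Complex.I * ((n : ℂ) - δ)) ^ k * Complex.exp (Complex.I * ((n + p : ℤ) : ℂ) * x)‖ =
      q ^ (((n : ℝ) - δ) ^ 2) * |(n : ℝ) - δ| ^ k := by
    intro n x
    rw [← hterm, norm_mul, norm_thetaDeriv_term hq,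
      show Complex.I * a * (x : ℂ) = (a * x : ℝ) * Complex.I by push_cast; ring,
      Complex.norm_exp_ofReal_mul_I, one_mul]
  have hs := summable_gauss_mul_abs_pow hq hq1 hδ k
  have h := hasSum_integral_of_summable_integral_norm
    (μ := volume.restrict (Set.Ioc (-Real.pi) Real.pi))
    (F := fun (n : ℤ) (x : ℝ) => ((q ^ (((n : ℝ) - δ) ^ 2) : ℝ) : ℂ) *
      (Complex.I * ((n : ℂ) - δ)) ^ k * Complex.exp (Complex.I * ((n + p : ℤ) : ℂ) * x))
    (fun n => by
      refine Continuous.integrableOn_Ioc ?_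
      fun_prop)
    (by
      simp_rw [hnorm, integral_const]
      exact hs.const_smul _)
  have e : ∀ x : ℝ, Complex.exp (Complex.I * a * (x : ℂ)) * thetaDeriv δ q k x =
      ∑' n : ℤ, ((q ^ (((n : ℝ) - δ) ^ 2) : ℝ) : ℂ) *
      (Complex.I * ((n : ℂ) - δ)) ^ k * Complex.exp (Complex.I * ((n + p : ℤ) : ℂ) * x) := by
    intro x
    rw [thetaDeriv, ← tsum_mul_left]
    simp_rw [hterm]
  simp_rw [e]
  rw [← h.tsum_eq, tsum_eq_single (-p)]
  · rw [integral_const_mul, integral_cexp_int_mul, if_pos (by ring)]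
    have e1 : (((-p : ℤ) : ℝ) - δ) ^ 2 = a ^ 2 := by rw [ha]; push_cast; ring
    have e2 : Complex.I * (((-p : ℤ) : ℂ) - δ) = -(Complex.I * a) := by rw [ha]; push_cast; ring
    rw [e1, e2]; ring
  · intro n hn
    rw [integral_const_mul, integral_cexp_int_mul, if_neg (by intro h; apply hn; linarith), mul_zero]

/-- The shift of the summation index in `thetaN`. -/
noncomputable def thetaShift (N : ℕ) : ℝ := if Even N then 1 / 2 else 0

theorem abs_thetaShift_le (N : ℕ) : |thetaShift N| ≤ 1 := by
  unfold thetaShift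
  split_ifs <;> norm_num [abs_le]

theorem thetaN_half (N : ℕ) (q : ℝ) :
    (fun y : ℝ => thetaN N ((y : ℂ) / 2) q) = thetaDeriv (thetaShift N) q 0 := by
  ext y
  unfold thetaN theta2 theta3 thetaDeriv thetaShift
  split_ifs
  · refine tsum_congr fun n => ?_
    rw [pow_zero, mul_one]
    congr 2
    push_cast; ring
  · refine tsum_congr fun n => ?_
    rw [pow_zero, mul_one]
    simp only [sub_zero]
    congr 2
    push_cast; ring

/-- The choice of θ₂ or θ₃ by the parity of N serves exactly this: the levels and the theta
frequencies lie in the same coset of ℤ. -/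
theorem exists_level_eq (N : ℕ) (j : Fin N) : ∃ p : ℤ, level N j = p + thetaShift N := by
  unfold level thetaShift
  split_ifs with h
  · obtain ⟨r, hr⟩ := h
    have h' : (N : ℝ) = (r : ℝ) + r := by rw [hr]; push_cast; rfl
    exact ⟨(j : ℤ) - r, by rw [h']; push_cast; ring⟩
  · obtain ⟨r, hr⟩ := Nat.not_even_iff_odd.1 h
    have h' : (N : ℝ) = 2 * (r : ℝ) + 1 := by rw [hr]; push_cast; rfl
    exact ⟨(j : ℤ) - r, by rw [h']; push_cast; ring⟩

/-! ### Averages of exponentials -/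

/-- Each 2i sin((x_k - x_j)/2) is a factor of the homogeneous Vandermonde determinant in e^(ix/2),
e^(-ix/2); the two complementary powers combine into the centred exponents. -/
theorem prod_sin_mul_eq_det {N : ℕ} (x : Fin N → ℝ) :
    ((∏ j : Fin N, ∏ k ∈ Finset.Ioi j, Real.sin ((x k - x j) / 2) : ℝ) : ℂ) *
      (∏ j : Fin N, ∏ _k ∈ Finset.Ioi j, (2 * Complex.I)) =
    (Matrix.of fun j k : Fin N => Complex.exp (Complex.I * level N k * x j)).det := by
  have e : (Matrix.of fun j k : Fin N => Complex.exp (Complex.I * level N k * x j)) =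
      Matrix.projVandermonde (fun j => Complex.exp (x j / 2 * Complex.I))
        (fun j => Complex.exp (-(x j / 2) * Complex.I)) := by
    ext j k
    rw [Matrix.projVandermonde_apply, Matrix.of_apply, ← Complex.exp_nat_mul, ← Complex.exp_nat_mul,
      ← Complex.exp_add]
    congr 1
    have : ((k.rev : ℕ) : ℂ) = N - (k + 1) := by
      rw [Fin.val_rev, Nat.cast_sub (by omega)]; push_cast; ring
    rw [this, level]
    push_cast
    ring
  rw [e, Matrix.det_projVandermonde]
  push_cast
  rw [← Finset.prod_mul_distrib]
  refine Finset.prod_congr rfl fun j _ => ?_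
  rw [← Finset.prod_mul_distrib]
  refine Finset.prod_congr rfl fun k _ => ?_
  rw [← Complex.exp_add, ← Complex.exp_add, Complex.sin]
  have e1 : (x k : ℂ) / 2 * Complex.I + -(x j / 2) * Complex.I = (x k - x j) / 2 * Complex.I := by
    ring
  have e2 : (x j : ℂ) / 2 * Complex.I + -(x k / 2) * Complex.I = -((x k - x j) / 2) * Complex.I := by
    ring
  rw [e1, e2]
  linear_combination (Complex.exp (-(((x k : ℂ) - x j) / 2) * Complex.I) -
    Complex.exp (((x k : ℂ) - x j) / 2 * Complex.I)) * Complex.I_sq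

theorem det_vandermonde_mul {R : Type*} [CommRing R] {N : ℕ} (c : R) (z : Fin N → R) :
    (Matrix.vandermonde fun j => c * z j).det =
      (∏ j : Fin N, ∏ _k ∈ Finset.Ioi j, c) * (Matrix.vandermonde z).det := by
  rw [Matrix.det_vandermonde, Matrix.det_vandermonde, ← Finset.prod_mul_distrib]
  refine Finset.prod_congr rfl fun j _ => ?_
  rw [← Finset.prod_mul_distrib]
  exact Finset.prod_congr rfl fun k _ => by ring

theorem nome_pos (N : ℕ) (t : ℝ) : 0 < nome N t := Real.exp_pos _

theorem nome_lt_one {N : ℕ} (hN : 1 ≤ N) {t : ℝ} (ht : 0 < t) : nome N t < 1 := by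
  have : (0 : ℝ) < N := by exact_mod_cast hN
  rw [nome, Real.exp_lt_one_iff, neg_div]
  exact neg_neg_of_pos (by positivity)

theorem sum_level_sq (N : ℕ) :
    ∑ j, level N j ^ 2 = (N : ℝ) * ((N : ℝ) ^ 2 - 1) / 12 := by
  have h : ∀ (M : ℕ) (c : ℝ), ∑ j ∈ Finset.range M, ((j : ℝ) - c) ^ 2 =
      (M : ℝ) * (M - 1) * (2 * M - 1) / 6 - c * (M * (M - 1)) + M * c ^ 2 := by
    intro M c
    induction M with
    | zero => simp
    | succ M ih => rw [Finset.sum_range_succ, ih]; push_cast; ring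
  unfold level
  rw [Fin.sum_univ_eq_sum_range (fun j => ((j : ℝ) - ((N : ℝ) - 1) / 2) ^ 2), h]
  ring

/-- The Vandermonde determinant is translation invariant, so at the levels it is the superfactorial.
With `sum_level_sq` this turns the constant of the density into the denominators of `weight` and the
1/N! of the mean over relabellings. -/
theorem prod_factorial_eq (N : ℕ) (hN : 1 ≤ N) :
    ∏ l ∈ Finset.Icc 1 N, (l.factorial : ℝ) =
      N.factorial * (Matrix.vandermonde (level N)).det := by
  obtain ⟨n, rfl⟩ : ∃ n, N = n + 1 := ⟨N - 1, by omega⟩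
  have : level (n + 1) = fun i : Fin (n + 1) => ((i : ℕ) : ℝ) + -(((n + 1 : ℕ) : ℝ) - 1) / 2 := by
    ext i; rw [level]; ring
  rw [this, Matrix.det_vandermonde_add, Matrix.det_vandermonde_id_eq_superFactorial,
    ← Nat.prod_Icc_factorial, Finset.prod_Icc_succ_top (by omega)]
  push_cast
  ring

theorem vandermonde_add_comp_perm {R : Type*} [CommRing R] {N : ℕ} (y m : Fin N → R)
    (σ : Equiv.Perm (Fin N)) :
    (Matrix.vandermonde fun j => m j + y (σ j)).det =
      (Equiv.Perm.sign σ : ℤ) * (Matrix.vandermonde (y + m ∘ σ.symm)).det := by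
  rw [← Matrix.det_permute σ]
  congr 1
  ext i j
  simp [Matrix.vandermonde_apply, add_comm]

/-- Both determinants are opened, σ for the sines and ρ for the theta functions, so that each
summand is a product of functions of one variable and can be integrated factor by factor. -/
theorem cexp_mul_jointDensity_eq {N : ℕ} (hN : 1 ≤ N) {t : ℝ} (ht : 0 < t) (m : Fin N → ℤ)
    (x : Fin N → ℝ) :
    Complex.exp (Complex.I * ∑ j, (m j : ℂ) * x j) * jointDensity N t x =
      ((nome N t ^ (-((N : ℝ) * ((N : ℝ) ^ 2 - 1) / 12)) /
        ((2 * Real.pi) ^ N * ∏ l ∈ Finset.Icc 1 N, (l.factorial : ℝ)) : ℝ) : ℂ) *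
      (∏ j : Fin N, ∏ _k ∈ Finset.Ioi j, (2 * Complex.I))⁻¹ *
      ∑ σ : Equiv.Perm (Fin N), ∑ ρ : Equiv.Perm (Fin N),
        ((Equiv.Perm.sign σ : ℤ) : ℂ) * ((Equiv.Perm.sign ρ : ℤ) : ℂ) *
        ∏ j, (Complex.exp (Complex.I * ((m j + level N (σ j) : ℝ) : ℂ) * x j) *
          ((-2) ^ (ρ j : ℕ) * thetaDeriv (thetaShift N) (nome N t) (ρ j) (x j))) := by
  have hK : (∏ j : Fin N, ∏ _k ∈ Finset.Ioi j, (2 * Complex.I)) ≠ 0 :=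
    Finset.prod_ne_zero_iff.2 fun j _ => Finset.prod_ne_zero_iff.2 fun k _ => by simp
  have hs := prod_sin_mul_eq_det x
  rw [← eq_mul_inv_iff_mul_eq₀ hK] at hs
  rw [jointDensity, hs]
  simp_rw [thetaN_half, iteratedDeriv_thetaDeriv (nome_pos N t) (nome_lt_one hN ht)
    (abs_thetaShift_le N)]
  rw [← Matrix.det_transpose, Matrix.det_apply', ← Matrix.det_transpose (Matrix.of _),
    Matrix.det_apply']
  simp only [Matrix.transpose_apply, Matrix.of_apply]
  have hcomm : ∀ E C S K T : ℂ, E * (C * (S * K) * T) = C * K * (E * (S * T)) := by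
    intros; ring
  rw [hcomm]
  congr 1
  rw [Finset.sum_mul_sum, Finset.mul_sum]
  refine Finset.sum_congr rfl fun σ _ => ?_
  rw [Finset.mul_sum]
  refine Finset.sum_congr rfl fun ρ _ => ?_
  rw [Finset.mul_sum, Complex.exp_sum, Finset.prod_mul_distrib (g := fun j : Fin N =>
    (-2 : ℂ) ^ (ρ j : ℕ) * thetaDeriv (thetaShift N) (nome N t) (ρ j) (x j))]
  have e : ∀ j, Complex.exp (Complex.I * ((m j + level N (σ j) : ℝ) : ℂ) * x j) =
      Complex.exp (Complex.I * ((m j : ℂ) * x j)) *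
        Complex.exp (Complex.I * level N (σ j) * x j) := by
    intro j
    rw [← Complex.exp_add]
    congr 1
    push_cast; ring
  simp_rw [e]
  rw [Finset.prod_mul_distrib (f := fun j => Complex.exp (Complex.I * ((m j : ℂ) * x j)))]
  ring

theorem continuous_thetaFactor {N : ℕ} (hN : 1 ≤ N) {t : ℝ} (ht : 0 < t) (a : ℝ) (k : ℕ) :
    Continuous fun x : ℝ => Complex.exp (Complex.I * (a : ℂ) * x) *
      ((-2) ^ k * thetaDeriv (thetaShift N) (nome N t) k x) := by
  have := continuous_thetaDeriv (nome_pos N t) (nome_lt_one hN ht) (abs_thetaShift_le N) k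
  fun_prop

theorem volume_restrict_box (N : ℕ) :
    (volume : Measure (Fin N → ℝ)).restrict
      (Set.univ.pi (fun _ : Fin N => Set.Ioc (-Real.pi) Real.pi)) =
    Measure.pi fun _ => volume.restrict (Set.Ioc (-Real.pi) Real.pi) := by
  rw [volume_pi, Measure.restrict_pi_pi]

theorem integrable_prod_thetaFactor {N : ℕ} (hN : 1 ≤ N) {t : ℝ} (ht : 0 < t) (a : Fin N → ℝ)
    (k : Fin N → ℕ) :
    Integrable (fun x : Fin N → ℝ => ∏ j, (Complex.exp (Complex.I * (a j : ℂ) * x j) *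
      ((-2) ^ (k j) * thetaDeriv (thetaShift N) (nome N t) (k j) (x j))))
      (Measure.pi fun _ => volume.restrict (Set.Ioc (-Real.pi) Real.pi)) :=
  Integrable.fintype_prod (f := fun j (x : ℝ) => Complex.exp (Complex.I * (a j : ℂ) * x) *
      ((-2) ^ (k j) * thetaDeriv (thetaShift N) (nome N t) (k j) x))
    fun j => (continuous_thetaFactor hN ht (a j) (k j)).integrableOn_Ioc

theorem integrableOn_cexp_mul_jointDensity {N : ℕ} (hN : 1 ≤ N) {t : ℝ} (ht : 0 < t)
    (m : Fin N → ℤ) :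
    IntegrableOn (fun x : Fin N → ℝ =>
      Complex.exp (Complex.I * ∑ j, (m j : ℂ) * x j) * jointDensity N t x)
      (Set.univ.pi (fun _ : Fin N => Set.Ioc (-Real.pi) Real.pi)) := by
  rw [IntegrableOn, volume_restrict_box]
  simp_rw [cexp_mul_jointDensity_eq hN ht m]
  exact (integrable_finsetSum _ fun σ _ => integrable_finsetSum _ fun ρ _ =>
    (integrable_prod_thetaFactor hN ht _ _).const_mul _).const_mul _

theorem integral_thetaFactor {N : ℕ} (hN : 1 ≤ N) {t : ℝ} (ht : 0 < t) (n : ℤ) (j : Fin N)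
    (k : ℕ) :
    ∫ x in Set.Ioc (-Real.pi) Real.pi,
      (Complex.exp (Complex.I * ((n + level N j : ℝ) : ℂ) * (x : ℂ)) *
        ((-2) ^ k * thetaDeriv (thetaShift N) (nome N t) k x)) =
      2 * Real.pi * ((nome N t ^ ((n + level N j) ^ 2) : ℝ) : ℂ) *
        (2 * Complex.I * ((n + level N j : ℝ) : ℂ)) ^ k := by
  obtain ⟨p, hp⟩ := exists_level_eq N j
  have h := integral_cexp_mul_thetaDeriv (nome_pos N t) (nome_lt_one hN ht)
    (abs_thetaShift_le N) k (a := n + level N j) (p := n + p) (by rw [hp]; push_cast; ring)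
  simp_rw [mul_left_comm _ ((-2 : ℂ) ^ k)]
  rw [integral_const_mul, h, mul_left_comm, ← mul_pow]
  congr 2
  ring

/-- The average of an exponential is the mean of its weights over all relabellings. -/
theorem average_cexp {N : ℕ} (hN : 1 ≤ N) {t : ℝ} (ht : 0 < t) (m : Fin N → ℤ) :
    ∫ x in Set.univ.pi (fun _ : Fin N => Set.Ioc (-Real.pi) Real.pi),
      Complex.exp (Complex.I * ∑ j, (m j : ℂ) * x j) * jointDensity N t x =
    (((N.factorial : ℝ)⁻¹ * ∑ σ : Equiv.Perm (Fin N),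
      weight N (nome N t) fun j => (m (σ j) : ℝ) : ℝ) : ℂ) := by
  have hq := nome_pos N t
  rw [volume_restrict_box]
  simp_rw [cexp_mul_jointDensity_eq hN ht m]
  rw [integral_const_mul, integral_finsetSum _ fun σ _ => integrable_finsetSum _ fun ρ _ =>
    (integrable_prod_thetaFactor hN ht _ _).const_mul _]
  set K := (∏ j : Fin N, ∏ _k ∈ Finset.Ioi j, (2 * Complex.I)) with hKdef
  have hK : K ≠ 0 :=
    Finset.prod_ne_zero_iff.2 fun j _ => Finset.prod_ne_zero_iff.2 fun k _ => by simp
  have hσ : ∀ σ : Equiv.Perm (Fin N), ∫ x : Fin N → ℝ, (∑ ρ : Equiv.Perm (Fin N),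
        ((Equiv.Perm.sign σ : ℤ) : ℂ) * ((Equiv.Perm.sign ρ : ℤ) : ℂ) *
        ∏ j, (Complex.exp (Complex.I * ((m j + level N (σ j) : ℝ) : ℂ) * x j) *
          ((-2) ^ (ρ j : ℕ) * thetaDeriv (thetaShift N) (nome N t) (ρ j) (x j))))
        ∂(Measure.pi fun _ => volume.restrict (Set.Ioc (-Real.pi) Real.pi)) =
      (2 * Real.pi) ^ N * K * ((nome N t ^ (∑ j, level N j ^ 2) *
        (Matrix.vandermonde (level N)).det *
        weight N (nome N t) fun j => (m (σ.symm j) : ℝ) : ℝ) : ℂ) := by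
    intro σ
    rw [integral_finsetSum _ fun ρ _ => (integrable_prod_thetaFactor hN ht _ _).const_mul _]
    have hρ : ∀ ρ : Equiv.Perm (Fin N), ∫ x : Fin N → ℝ,
        ((Equiv.Perm.sign σ : ℤ) : ℂ) * ((Equiv.Perm.sign ρ : ℤ) : ℂ) *
        ∏ j, (Complex.exp (Complex.I * ((m j + level N (σ j) : ℝ) : ℂ) * x j) *
          ((-2) ^ (ρ j : ℕ) * thetaDeriv (thetaShift N) (nome N t) (ρ j) (x j)))
        ∂(Measure.pi fun _ => volume.restrict (Set.Ioc (-Real.pi) Real.pi)) =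
        ((Equiv.Perm.sign σ : ℤ) : ℂ) * ((2 * Real.pi) ^ N *
          ((nome N t ^ (∑ j, (m j + level N (σ j)) ^ 2) : ℝ) : ℂ)) *
          (((Equiv.Perm.sign ρ : ℤ) : ℂ) *
            ∏ j, (2 * Complex.I * ((m j + level N (σ j) : ℝ) : ℂ)) ^ (ρ j : ℕ)) := by
      intro ρ
      rw [integral_const_mul, integral_fintype_prod_eq_prod
        (f := fun j (x : ℝ) => Complex.exp (Complex.I * ((m j + level N (σ j) : ℝ) : ℂ) * x) *
          ((-2) ^ (ρ j : ℕ) * thetaDeriv (thetaShift N) (nome N t) (ρ j) x))]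
      simp_rw [integral_thetaFactor hN ht]
      rw [Finset.prod_mul_distrib, Finset.prod_mul_distrib, Finset.prod_const, Finset.card_univ,
        Fintype.card_fin, Real.rpow_sum_of_pos hq]
      push_cast
      ring
    simp_rw [hρ]
    rw [← Finset.mul_sum]
    -- The sum over ρ closes up to a Vandermonde determinant. Its factor 2i per pair cancels the one
    -- from the sines, and sorting its nodes costs a second sign of σ, which cancels the first.
    have hdet : ∑ ρ : Equiv.Perm (Fin N), (((Equiv.Perm.sign ρ : ℤ) : ℂ) *
            ∏ j, (2 * Complex.I * ((m j + level N (σ j) : ℝ) : ℂ)) ^ (ρ j : ℕ)) =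
        K * ((Equiv.Perm.sign σ : ℤ) *
          (Matrix.vandermonde (level N + fun j => (m (σ.symm j) : ℝ))).det : ℝ) := by
      have h1 := det_vandermonde_mul (2 * Complex.I)
        (fun j => ((m j + level N (σ j) : ℝ) : ℂ))
      have h2 := vandermonde_add_comp_perm (level N) (fun j => (m j : ℝ)) σ
      have h3 : (Matrix.vandermonde fun j => ((m j + level N (σ j) : ℝ) : ℂ)).det =
          (((Matrix.vandermonde fun j => (m j + level N (σ j) : ℝ)).det : ℝ) : ℂ) := by
        simp [Matrix.det_vandermonde]
      rw [h3, h2] at h1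
      rw [← Matrix.det_transpose, Matrix.det_apply'] at h1
      exact h1
    rw [hdet, weight, Finset.sum_sub_distrib, Real.rpow_sub hq]
    have hsum : ∑ j, (m j + level N (σ j)) ^ 2 = ∑ j, (level N j + (m (σ.symm j) : ℝ)) ^ 2 := by
      rw [← Equiv.sum_comp σ fun j => (level N j + (m (σ.symm j) : ℝ)) ^ 2]
      simp [add_comm]
    rw [hsum]
    have hs : ((Equiv.Perm.sign σ : ℤ) : ℂ) * ((Equiv.Perm.sign σ : ℤ) : ℂ) = 1 := by
      norm_cast
      simp
    have hv := det_vandermonde_level_ne_zero N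
    have hq' := (Real.rpow_pos_of_pos hq (∑ j, level N j ^ 2)).ne'
    have e : ∀ A B C D : ℝ, A ≠ 0 → B ≠ 0 → A * B * (C / A * (D / B)) = C * D := by
      intro A B C D hA hB
      field_simp
    rw [e _ _ _ _ hq' hv]
    push_cast
    linear_combination ((2 * Real.pi : ℂ) ^ N *
      ((nome N t ^ (∑ j, (level N j + (m (σ.symm j) : ℝ)) ^ 2) : ℝ) : ℂ) * K *
      (((Matrix.vandermonde (level N + fun j => (m (σ.symm j) : ℝ))).det : ℝ) : ℂ)) * hs
  simp_rw [hσ]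
  rw [← Finset.mul_sum, ← sum_level_sq, prod_factorial_eq N hN, Real.rpow_neg hq.le]
  rw [← Equiv.sum_comp (Equiv.inv (Equiv.Perm (Fin N))) (fun σ => weight N (nome N t)
    fun j => (m (σ j) : ℝ))]
  have hv := det_vandermonde_level_ne_zero N
  have hq' := (Real.rpow_pos_of_pos hq (∑ j, level N j ^ 2)).ne'
  have hv' : (((Matrix.vandermonde (level N)).det : ℝ) : ℂ) ≠ 0 := by exact_mod_cast hv
  have hq'' : ((nome N t ^ (∑ j, level N j ^ 2) : ℝ) : ℂ) ≠ 0 := by exact_mod_cast hq'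
  have hpi : (Real.pi : ℂ) ≠ 0 := by exact_mod_cast Real.pi_ne_zero
  have hf : (N.factorial : ℂ) ≠ 0 := by exact_mod_cast N.factorial_ne_zero
  push_cast
  rw [← Finset.mul_sum]
  simp only [Equiv.inv_apply, Equiv.Perm.inv_def]
  field_simp

/-! ### Moments and the form factor as a finite sum -/

/-- For a family of exponents whose total weight is invariant under relabelling, the mean over
permutations disappears. -/
theorem average_sum_cexp {N : ℕ} (hN : 1 ≤ N) {t : ℝ} (ht : 0 < t) {ι : Type*} [Fintype ι]
    (m : ι → Fin N → ℤ)
    (hm : ∀ σ : Equiv.Perm (Fin N), ∑ i, weight N (nome N t) (fun j => (m i (σ j) : ℝ)) =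
      ∑ i, weight N (nome N t) (fun j => (m i j : ℝ))) :
    average N t (fun x => ∑ i, Complex.exp (Complex.I * ∑ j, (m i j : ℂ) * x j)) =
      ((∑ i, weight N (nome N t) (fun j => (m i j : ℝ)) : ℝ) : ℂ) := by
  rw [average, if_neg ht.ne']
  simp_rw [Finset.sum_mul]
  rw [integral_finsetSum _ fun i _ => integrableOn_cexp_mul_jointDensity hN ht (m i)]
  simp_rw [average_cexp hN ht]
  rw [← Complex.ofReal_sum, ← Finset.mul_sum, Finset.sum_comm]
  simp_rw [hm]
  rw [Finset.sum_const, Finset.card_univ, Fintype.card_perm, Fintype.card_fin, nsmul_eq_mul,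
    inv_mul_cancel_left₀ (by exact_mod_cast N.factorial_ne_zero)]

theorem single_comp_perm {N : ℕ} {M : Type*} [Zero M] (σ : Equiv.Perm (Fin N)) (l j : Fin N)
    (c : M) : (Pi.single l c : Fin N → M) (σ j) = (Pi.single (σ.symm l) c : Fin N → M) j := by
  by_cases h : σ j = l
  · subst h; simp
  · have : j ≠ σ.symm l := fun h' => h (by simp [h'])
    simp [h, this]

theorem weight_one (N : ℕ) (m : Fin N → ℝ) :
    weight N 1 m = (Matrix.vandermonde (level N + m)).det / (Matrix.vandermonde (level N)).det := by
  simp [weight]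

theorem sum_det_vandermonde_add_single {R : Type*} [CommRing R] {N : ℕ} (y : Fin N → R) (c : R) :
    ∑ l, (Matrix.vandermonde (y + Pi.single l c)).det = N * (Matrix.vandermonde y).det := by
  rw [← sum_det_vandermonde_update_add y c]
  refine Finset.sum_congr rfl fun l _ => ?_
  congr 2
  ext j
  by_cases h : j = l
  · subst h; simp
  · simp [h]

theorem sum_weight_one_single (N : ℕ) (c : ℝ) : ∑ l, weight N 1 (Pi.single l c) = N := by
  simp_rw [weight_one]
  rw [← Finset.sum_div, sum_det_vandermonde_add_single,
    mul_div_cancel_right₀ _ (det_vandermonde_level_ne_zero N)]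

/-- The averaged shift identity is used twice: over l with the node l' already moved by -c, then
over l'. -/
theorem sum_weight_one_single_sub_single (N : ℕ) (c : ℝ) :
    ∑ l, ∑ l', weight N 1 (Pi.single l c - Pi.single l' c) = N * N := by
  have h : ∀ l', ∑ l, (Matrix.vandermonde
      (level N + (Pi.single l c - Pi.single l' c : Fin N → ℝ))).det =
      N * (Matrix.vandermonde (level N + Pi.single l' (-c))).det := by
    intro l'
    rw [← sum_det_vandermonde_add_single _ c]
    refine Finset.sum_congr rfl fun l _ => ?_
    rw [Pi.single_neg]
    congr 2
    abel
  rw [Finset.sum_comm]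
  simp_rw [weight_one, ← Finset.sum_div, h]
  rw [← Finset.mul_sum, sum_det_vandermonde_add_single, ← mul_assoc,
    mul_div_cancel_right₀ _ (det_vandermonde_level_ne_zero N)]

theorem nome_zero (N : ℕ) : nome N 0 = 1 := by simp [nome]

theorem average_sum_single {N : ℕ} (hN : 1 ≤ N) {t : ℝ} (ht : 0 ≤ t) (c : ℤ) :
    average N t (fun x => ∑ l, Complex.exp (Complex.I * c * (x l : ℂ))) =
      ((∑ l, weight N (nome N t) (Pi.single l (c : ℝ)) : ℝ) : ℂ) := by
  -- At t = 0 the left side is evaluation at the origin, which gives N; the weights at q = 1 have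
  -- the same sum.
  rcases ht.eq_or_lt with rfl | ht
  · rw [nome_zero, sum_weight_one_single]
    simp [average]
  have hcast : ∀ l : Fin N, (fun j => (((Pi.single l c : Fin N → ℤ) j : ℤ) : ℝ)) =
      Pi.single l (c : ℝ) := by
    intro l; ext j
    by_cases h : j = l
    · subst h; simp
    · simp [h]
  have h := average_sum_cexp hN ht (fun l : Fin N => (Pi.single l c : Fin N → ℤ)) (by
    intro σ
    simp_rw [single_comp_perm, hcast]
    exact Equiv.sum_comp σ.symm fun l => weight N (nome N t) (Pi.single l (c : ℝ)))
  simp_rw [hcast] at h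
  rw [← h]
  congr 1
  ext x
  refine Finset.sum_congr rfl fun l _ => ?_
  rw [Finset.sum_eq_single l]
  · simp [mul_assoc]
  · intro j _ hj; simp [hj]
  · simp

theorem average_sum_pair {N : ℕ} (hN : 1 ≤ N) {t : ℝ} (ht : 0 ≤ t) (c : ℤ) :
    average N t (fun x => ∑ l, ∑ l', Complex.exp (Complex.I * c * ((x l : ℂ) - (x l' : ℂ)))) =
      ((∑ l, ∑ l', weight N (nome N t) (Pi.single l (c : ℝ) - Pi.single l' (c : ℝ)) : ℝ) : ℂ) := by
  rcases ht.eq_or_lt with rfl | ht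
  · rw [nome_zero, sum_weight_one_single_sub_single]
    simp [average]
  have hcast : ∀ l l' : Fin N,
      (fun j => (((Pi.single l c : Fin N → ℤ) j - (Pi.single l' c : Fin N → ℤ) j : ℤ) : ℝ)) =
      Pi.single l (c : ℝ) - Pi.single l' (c : ℝ) := by
    intro l l'; ext j
    simp [Pi.single_apply]
  have h := average_sum_cexp hN ht (fun (p : Fin N × Fin N) j =>
      (Pi.single p.1 c : Fin N → ℤ) j - (Pi.single p.2 c : Fin N → ℤ) j) (by
    intro σ
    simp_rw [single_comp_perm, hcast, Fintype.sum_prod_type]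
    rw [Equiv.sum_comp σ.symm fun l => ∑ l', weight N (nome N t)
      ((Pi.single l (c : ℝ) : Fin N → ℝ) - (Pi.single (σ.symm l') (c : ℝ) : Fin N → ℝ))]
    exact Finset.sum_congr rfl fun l _ => Equiv.sum_comp σ.symm fun l' => weight N (nome N t)
      ((Pi.single l (c : ℝ) : Fin N → ℝ) - (Pi.single l' (c : ℝ) : Fin N → ℝ)))
  simp_rw [hcast, Fintype.sum_prod_type] at h
  rw [← h]
  refine congrArg (average N t) (funext fun x => ?_)
  refine Finset.sum_congr rfl fun l _ => Finset.sum_congr rfl fun l' _ => ?_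
  have hs : ∀ l : Fin N, ∑ j, (((Pi.single l c : Fin N → ℤ) j : ℤ) : ℂ) * x j = c * x l := by
    intro l
    rw [Finset.sum_eq_single l]
    · simp
    · intro j _ hj; simp [hj]
    · simp
  push_cast
  simp_rw [sub_mul]
  rw [Finset.sum_sub_distrib, hs, hs]
  congr 1
  ring

/-- One formula for all pairs. For l = l' the last factor is zero and the indicator supplies 1. For
l' = l + k the nodes are exchanged, giving -1; there the denominator is zero, but so is the first
single weight, so the conventional value of the quotient is harmless. -/
theorem weight_pair_eq {N : ℕ} {q : ℝ} (hq : 0 < q) {k : ℕ} (hk : 1 ≤ k) (l l' : Fin N) :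
    weight N q (Pi.single l (k : ℝ) - Pi.single l' (k : ℝ)) =
      (if l = l' then 1 else 0) - (if (l' : ℕ) = l + k then 1 else 0) +
      weight N q (Pi.single l (k : ℝ)) * weight N q (Pi.single l' (-(k : ℝ))) *
        (1 - (k : ℝ) ^ 2 / (level N l - level N l' + k) ^ 2) := by
  have hk0 : (k : ℝ) ≠ 0 := by positivity
  by_cases hl : l = l'
  · subst hl
    rw [sub_self, weight_zero, sub_self, zero_add, div_self (pow_ne_zero 2 hk0), if_pos rfl,
      if_neg (show ¬(l : ℕ) = l + k by omega)]
    ring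
  · rw [if_neg hl]
    by_cases h : (l' : ℕ) = l + k
    · have h' : level N l' = level N l + k := by
        have : ((l' : ℕ) : ℝ) = (l : ℕ) + k := by exact_mod_cast h
        rw [level, level, this]; ring
      rw [if_pos h, weight_single_sub_single_swap hl h', weight_single_eq_zero hl h']
      ring
    · have h' : level N l - level N l' + k ≠ 0 := by
        intro h0
        apply h
        have : ((l' : ℕ) : ℝ) = (l : ℕ) + k := by rw [level, level] at h0; linarith
        exact_mod_cast this
      rw [if_neg h, weight_single_sub_single hq hl h']
      ring

theorem sum_ite_eq_add (N k : ℕ) :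
    ∑ l : Fin N, ∑ l' : Fin N, (if (l' : ℕ) = l + k then (1 : ℝ) else 0) = (N - k : ℕ) := by
  have h : ∀ l : Fin N, ∑ l' : Fin N, (if (l' : ℕ) = l + k then (1 : ℝ) else 0) =
      if (l : ℕ) < N - k then 1 else 0 := by
    intro l
    split_ifs with hl
    · rw [Finset.sum_eq_single (⟨l + k, by omega⟩ : Fin N)]
      · simp
      · intro j _ hj
        rw [if_neg fun h => hj (Fin.ext h)]
      · simp
    · exact Finset.sum_eq_zero fun j _ => if_neg (by omega)
  simp_rw [h]
  rw [Fin.sum_univ_eq_sum_range (fun l => if l < N - k then (1 : ℝ) else 0), ← Finset.sum_filter,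
    Finset.sum_const, nsmul_one]
  congr 1
  rw [show (Finset.range N).filter (· < N - k) = Finset.range (N - k) by ext; simp; omega]
  simp

theorem formFactor_eq_sub_sum {N k : ℕ} (hN : 1 ≤ N) (hk : 1 ≤ k) {t : ℝ} (ht : 0 ≤ t) :
    formFactor N k t = ((((min k N : ℕ) : ℝ) - (k : ℝ) ^ 2 * ∑ l, ∑ l',
      weight N (nome N t) (Pi.single l (k : ℝ)) * weight N (nome N t) (Pi.single l' (-(k : ℝ))) /
        (level N l - level N l' + k) ^ 2 : ℝ) : ℂ) := by
  have h1 := average_sum_pair hN ht k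
  have h2 := average_sum_single hN ht k
  have h3 := average_sum_single hN ht (-k)
  rw [formFactor, h1, h2]
  have e : (fun x : Fin N → ℝ => ∑ l, Complex.exp (-(Complex.I * ((k : ℤ) : ℂ) * (x l : ℂ)))) =
      fun x => ∑ l, Complex.exp (Complex.I * ((-(k : ℤ) : ℤ) : ℂ) * (x l : ℂ)) := by
    ext x
    refine Finset.sum_congr rfl fun l _ => ?_
    push_cast
    rw [mul_neg, neg_mul]
  rw [e, h3, ← Complex.ofReal_mul, ← Complex.ofReal_sub, Complex.ofReal_inj]
  push_cast
  simp_rw [weight_pair_eq (nome_pos N t) hk, Finset.sum_add_distrib, Finset.sum_sub_distrib,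
    sum_ite_eq_add]
  rw [Finset.sum_mul_sum]
  simp_rw [mul_sub, mul_one, Finset.sum_sub_distrib, mul_div_left_comm _ ((k : ℝ) ^ 2),
    Finset.mul_sum]
  -- The subtraction N - k is truncated, so this also covers k > N.
  have hmin : ((min k N : ℕ) : ℝ) = N - (N - k : ℕ) := by
    rw [eq_sub_iff_add_eq]
    norm_cast
    omega
  push_cast at hmin
  rw [hmin]
  simp
  ring

/-! ### Terminating hypergeometric sums -/

/-- The coefficients of `(n + m + 1)! / (n! m!) · ₂F₁(-n, -m; -(n + m + 1); z)`. -/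
noncomputable def hyperCoeff (n m u : ℕ) : ℝ :=
  (-1) ^ u * (n.descFactorial u * m.descFactorial u * (n + m + 1 - u).factorial : ℕ) /
    (n.factorial * m.factorial * u.factorial : ℕ)

theorem hyperCoeff_eq_zero_right {n m u : ℕ} (h : m < u) : hyperCoeff n m u = 0 := by
  simp [hyperCoeff, Nat.descFactorial_of_lt h]

theorem ascPochhammer_eval_neg_nat (n u : ℕ) :
    (ascPochhammer ℝ u).eval (-(n : ℝ)) = (-1) ^ u * (n.descFactorial u : ℝ) := by
  rw [ascPochhammer_eval_neg_eq_descPochhammer, descPochhammer_eval_eq_descFactorial]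

/-- The upper parameter -n ends the series after u = n whatever c is: later terms vanish through
their numerators even if the Pochhammer symbol of c is zero. -/
theorem ordinaryHypergeometric_neg_nat (n m : ℕ) (c z : ℝ) :
    ordinaryHypergeometric (-(n : ℝ)) (-(m : ℝ)) c z = ∑ u ∈ Finset.range (n + 1),
      (n.descFactorial u : ℝ) * m.descFactorial u / u.factorial *
        ((ascPochhammer ℝ u).eval c)⁻¹ * z ^ u := by
  simp only [ordinaryHypergeometric_eq_tsum]
  rw [tsum_eq_sum (s := Finset.range (n + 1))]
  · refine Finset.sum_congr rfl fun u _ => ?_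
    rw [ascPochhammer_eval_neg_nat, ascPochhammer_eval_neg_nat, smul_eq_mul]
    have : ((-1 : ℝ) ^ u) * (-1) ^ u = 1 := by rw [← mul_pow]; simp
    linear_combination ((n.descFactorial u : ℝ) * m.descFactorial u / u.factorial *
        ((ascPochhammer ℝ u).eval c)⁻¹ * z ^ u) * this
  · intro u hu
    rw [ascPochhammer_eval_neg_nat, Nat.descFactorial_of_lt (by simpa using hu)]
    simp

theorem factorial_mul_hypergeometric_neg (n m : ℕ) (z : ℝ) :
    ((n + m + 1).factorial / (m.factorial * n.factorial) : ℝ) *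
      ordinaryHypergeometric (-(n : ℝ)) (-(m : ℝ)) (-((n + m + 1 : ℕ) : ℝ)) z =
      ∑ u ∈ Finset.range (n + 1), hyperCoeff n m u * z ^ u := by
  rw [ordinaryHypergeometric_neg_nat, Finset.mul_sum]
  refine Finset.sum_congr rfl fun u hu => ?_
  have hu' : u ≤ n := by simpa [Nat.lt_succ_iff] using hu
  rw [ascPochhammer_eval_neg_nat, hyperCoeff,
    ← Nat.factorial_mul_descFactorial (show u ≤ n + m + 1 by omega)]
  have h : ((n + m + 1).descFactorial u : ℝ) ≠ 0 := by
    exact_mod_cast (Nat.descFactorial_eq_zero_iff_lt.not.2 (by omega))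
  have hs : ((-1 : ℝ) ^ u) ^ 2 = 1 := by rw [← pow_mul, mul_comm, pow_mul]; simp
  have hs0 : ((-1 : ℝ) ^ u) ≠ 0 := by simp
  push_cast
  field_simp
  rw [hs, mul_one]

theorem ascPochhammer_eval_two (u : ℕ) :
    (ascPochhammer ℝ u).eval 2 = ((u + 1).factorial : ℝ) := by
  have h := Nat.factorial_mul_ascFactorial 1 u
  rw [Nat.factorial_one, one_mul, add_comm 1 u] at h
  rw [← h, Nat.cast_ascFactorial]
  norm_num

/-- Trinomial revision pulls out `m.choose u`; reflecting `(n + 1).choose (j + 1)` leaves a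
Chu–Vandermonde convolution. -/
theorem sum_choose_mul_choose_mul_choose {n u : ℕ} (hu : u ≤ n) (m : ℕ) :
    ∑ j ∈ Finset.range (n + 1), (n + 1).choose (j + 1) * m.choose j * j.choose u =
      m.choose u * (n + 1 + (m - u)).choose (n - u) := by
  obtain ⟨d, rfl⟩ := Nat.exists_eq_add_of_le hu
  rw [add_assoc, Finset.sum_range_add, Finset.sum_eq_zero fun j hj => by
    rw [Nat.choose_eq_zero_of_lt (n := j) (by simpa using hj), mul_zero], zero_add,
    Nat.add_sub_cancel_left, add_comm _ (m - u), Nat.add_choose_eq,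
    Finset.Nat.sum_antidiagonal_eq_sum_range_succ
      (fun i j => (m - u).choose i * (u + (d + 1)).choose j), Finset.mul_sum]
  refine Finset.sum_congr rfl fun i hi => ?_
  have hi' : i ≤ d := by simpa [Nat.lt_succ_iff] using hi
  rw [mul_assoc, Nat.choose_mul (by omega), Nat.add_sub_cancel_left,
    ← Nat.choose_symm (show u + i + 1 ≤ u + (d + 1) by omega),
    show u + (d + 1) - (u + i + 1) = d - i by omega]
  ring

/-- The connection formula z ↦ 1 - z, checked on coefficients: times n + 1, the coefficient of (1 -
z)^j is a product of two binomials, and expanding (1 - z)^j leads to the preceding sum. -/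
theorem succ_mul_succ_mul_hypergeometric_two (n m : ℕ) (z : ℝ) :
    ((m : ℝ) + 1) * ((n : ℝ) + 1) *
      ordinaryHypergeometric (-(n : ℝ)) (-(m : ℝ)) 2 (1 - z) =
      ∑ u ∈ Finset.range (n + 1), hyperCoeff n m u * z ^ u := by
  have h1 : ∀ j, ((n : ℝ) + 1) * ((n.descFactorial j : ℝ) * m.descFactorial j / j.factorial *
        ((ascPochhammer ℝ j).eval 2)⁻¹ * (1 - z) ^ j) =
      (((n + 1).choose (j + 1) * m.choose j : ℕ) : ℝ) * (1 - z) ^ j := by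
    intro j
    have e : (n + 1) * n.descFactorial j = (j + 1).factorial * (n + 1).choose (j + 1) := by
      rw [← Nat.succ_descFactorial_succ, Nat.descFactorial_eq_factorial_mul_choose]
    have e' : ((n : ℝ) + 1) * n.descFactorial j = (j + 1).factorial * (n + 1).choose (j + 1) := by
      exact_mod_cast e
    rw [ascPochhammer_eval_two, Nat.descFactorial_eq_factorial_mul_choose m]
    push_cast
    field_simp
    linear_combination (m.choose j : ℝ) * (1 - z) ^ j * e'
  have h2 : ∀ j ∈ Finset.range (n + 1), (((n + 1).choose (j + 1) * m.choose j : ℕ) : ℝ) *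
      (1 - z) ^ j = ∑ u ∈ Finset.range (n + 1),
        (((n + 1).choose (j + 1) * m.choose j * j.choose u : ℕ) : ℝ) * ((-1) ^ u * z ^ u) := by
    intro j hj
    have hj' : j < n + 1 := by simpa using hj
    rw [sub_eq_neg_add, add_pow, Finset.mul_sum]
    refine (Finset.sum_subset_zero_on_sdiff (Finset.range_mono hj') (fun u hu => ?_)
      fun u _ => ?_)
    · rw [Nat.choose_eq_zero_of_lt (n := j) (by simp at hu; omega)]
      simp
    · rw [neg_pow]; push_cast; ring
  have h3 : ∀ u ∈ Finset.range (n + 1), ((m : ℝ) + 1) *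
      ((m.choose u * (n + 1 + (m - u)).choose (n - u) : ℕ) : ℝ) * (-1) ^ u =
      hyperCoeff n m u := by
    intro u hu
    have hu' : u ≤ n := by simpa [Nat.lt_succ_iff] using hu
    rcases lt_or_ge m u with hmu | hmu
    · rw [hyperCoeff_eq_zero_right hmu, Nat.choose_eq_zero_of_lt hmu]; simp
    · have e2 : (n + 1 + (m - u)).choose (n - u) =
          (n + m + 1 - u).factorial / ((n - u).factorial * (m + 1).factorial) := by
        rw [Nat.choose_eq_factorial_div_factorial (by omega)]
        congr 2 <;> congr 1 <;> omega
      have e1 := Nat.choose_mul_factorial_mul_factorial (show n - u ≤ n + 1 + (m - u) by omega)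
      rw [show n + 1 + (m - u) - (n - u) = m + 1 by omega,
        show n + 1 + (m - u) = n + m + 1 - u by omega] at e1
      have e3 := Nat.factorial_mul_descFactorial hu'
      rw [hyperCoeff, show n + 1 + (m - u) = n + m + 1 - u by omega, ← e1, ← e3,
        Nat.descFactorial_eq_factorial_mul_choose m, Nat.factorial_succ m]
      have hd : (n.descFactorial u : ℝ) ≠ 0 := by
        exact_mod_cast (Nat.descFactorial_eq_zero_iff_lt.not.2 (by omega))
      push_cast
      field_simp
  rw [ordinaryHypergeometric_neg_nat, mul_assoc, Finset.mul_sum]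
  simp_rw [h1]
  rw [Finset.sum_congr rfl h2, Finset.sum_comm, Finset.mul_sum]
  refine Finset.sum_congr rfl fun u hu => ?_
  rw [← h3 u hu, ← Finset.sum_mul, ← Nat.cast_sum,
    sum_choose_mul_choose_mul_choose (by simpa [Nat.lt_succ_iff] using hu)]
  ring

/-! ### The integral representation at finite `N` -/

theorem prod_fin_erase {M : Type*} [CommMonoid M] (f : ℕ → M) (u d : ℕ) (l : Fin (u + 1 + d))
    (hl : (l : ℕ) = u) :
    ∏ v ∈ Finset.univ.erase l, f v =
      (∏ v ∈ Finset.range u, f v) * ∏ i ∈ Finset.range d, f (u + 1 + i) := by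
  set g : ℕ → M := fun v => if v = u then 1 else f v with hg
  have h1 : ∏ v ∈ Finset.univ.erase l, f v = ∏ v : Fin (u + 1 + d), g v := by
    rw [← Finset.mul_prod_erase Finset.univ (fun v : Fin (u + 1 + d) => g v) (Finset.mem_univ l)]
    simp only [hg, hl, if_true, one_mul]
    refine Finset.prod_congr rfl fun v hv => ?_
    rw [if_neg]
    intro h
    exact (Finset.mem_erase.1 hv).1 (Fin.ext (h.trans hl.symm))
  rw [h1, Fin.prod_univ_eq_prod_range g, Finset.prod_range_add, Finset.prod_range_succ]
  simp only [hg, if_true, mul_one]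
  congr 1
  · exact Finset.prod_congr rfl fun v hv => if_neg (by simp at hv; omega)
  · exact Finset.prod_congr rfl fun v hv => if_neg (by omega)

theorem prod_fin_erase_sub {n : ℕ} (l : Fin (n + 1)) :
    ∏ v ∈ Finset.univ.erase l, (((v : ℕ) : ℝ) - ((l : ℕ) : ℝ)) =
      (-1) ^ (l : ℕ) * ((l : ℕ).factorial * (n - l).factorial) := by
  obtain ⟨u, hu⟩ := l
  obtain ⟨d, rfl⟩ := Nat.exists_eq_add_of_le (Nat.lt_succ_iff.1 hu)
  have e : u + d + 1 = u + 1 + d := by omega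
  -- The size is a variable `M`, so that u + d + 1 = u + 1 + d can be substituted inside `Fin`.
  have key : ∀ (M : ℕ) (_ : M = u + 1 + d) (l : Fin M) (_ : (l : ℕ) = u),
      ∏ v ∈ Finset.univ.erase l, (((v : ℕ) : ℝ) - (u : ℝ)) =
        (-1) ^ u * (u.factorial * d.factorial) := by
    rintro M rfl l hl
    rw [prod_fin_erase (fun v => (v : ℝ) - u) u d l hl, ← mul_assoc]
    congr 1
    · rw [← Finset.prod_range_reflect, ← Finset.prod_range_add_one_eq_factorial]
      push_cast
      rw [← Finset.card_range u, ← Finset.prod_const, Finset.card_range, ← Finset.prod_mul_distrib]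
      refine Finset.prod_congr rfl fun j hj => ?_
      have : j < u := by simpa using hj
      rw [Nat.sub_sub, Nat.cast_sub (by omega)]
      push_cast; ring
    · rw [← Finset.prod_range_add_one_eq_factorial]
      push_cast
      exact Finset.prod_congr rfl fun j _ => by ring
  have := key (u + d + 1) e ⟨u, hu⟩ rfl
  simpa using this

/-- The prefactor m + 1 is the missing factor v = l; it completes the numerator to n + 1 consecutive
integers, which include 0 exactly when l > m. -/
theorem succ_mul_prod_fin_erase {n : ℕ} (m : ℕ) (l : Fin (n + 1)) :
    ((m : ℝ) + 1) * ∏ v ∈ Finset.univ.erase l,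
      ((((v : ℕ) : ℝ) - ((l : ℕ) : ℝ) + (m + 1)) / (((v : ℕ) : ℝ) - ((l : ℕ) : ℝ))) =
      hyperCoeff n m l := by
  rw [Finset.prod_div_distrib, prod_fin_erase_sub, mul_div_assoc']
  have h1 : ((m : ℝ) + 1) * ∏ v ∈ Finset.univ.erase l,
      (((v : ℕ) : ℝ) - ((l : ℕ) : ℝ) + (m + 1)) =
      ∏ v ∈ Finset.range (n + 1), ((v : ℝ) - ((l : ℕ) : ℝ) + (m + 1)) := by
    rw [← Fin.prod_univ_eq_prod_range (fun v => (v : ℝ) - ((l : ℕ) : ℝ) + (m + 1)),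
      ← Finset.mul_prod_erase _ _ (Finset.mem_univ l)]
    simp
  rw [h1]
  rcases lt_or_ge m l with h | h
  · rw [hyperCoeff_eq_zero_right h, Finset.prod_eq_zero (i := (l : ℕ) - (m + 1)), zero_div]
    · simp; omega
    · rw [Nat.cast_sub h]; push_cast; ring
  · have h2 := Nat.factorial_mul_ascFactorial (m - l) (n + 1)
    rw [Nat.ascFactorial_eq_prod_range, show m - l + (n + 1) = n + m + 1 - l by omega] at h2
    have h3 : ∏ v ∈ Finset.range (n + 1), ((v : ℝ) - ((l : ℕ) : ℝ) + (m + 1)) =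
        ((∏ i ∈ Finset.range (n + 1), (m - l + 1 + i) : ℕ) : ℝ) := by
      push_cast
      refine Finset.prod_congr rfl fun v _ => ?_
      rw [Nat.cast_sub h]; ring
    have e3 := Nat.factorial_mul_descFactorial (show (l : ℕ) ≤ n by omega)
    have e4 := Nat.factorial_mul_descFactorial h
    rw [h3, hyperCoeff, ← h2, ← e3, ← e4]
    have hd : (n.descFactorial l : ℝ) ≠ 0 := by
      exact_mod_cast (Nat.descFactorial_eq_zero_iff_lt.not.2 (by omega))
    have hd' : (m.descFactorial l : ℝ) ≠ 0 := by
      exact_mod_cast (Nat.descFactorial_eq_zero_iff_lt.not.2 (by omega))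
    have hs : ((-1 : ℝ) ^ (l : ℕ)) ^ 2 = 1 := by rw [← pow_mul, mul_comm, pow_mul]; simp
    rw [Nat.cast_mul, Nat.cast_mul, Nat.cast_mul, Nat.cast_mul, Nat.cast_mul, Nat.cast_mul,
      Nat.cast_mul]
    field_simp
    rw [hs]

theorem level_rev {N : ℕ} (l : Fin N) : level N l.rev = -level N l := by
  rw [level, level, Fin.val_rev, Nat.cast_sub (by omega)]
  push_cast; ring

/-- Reflection symmetry of the levels. It turns forward shifts into backward ones, so both weights
in the double sum are given by the same coefficients. -/
theorem weight_single_rev {N : ℕ} (q c : ℝ) (l : Fin N) :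
    weight N q (Pi.single l.rev c) = weight N q (Pi.single l (-c)) := by
  rw [weight_single, weight_single, level_rev]
  congr 1
  · congr 1; ring
  · refine Finset.prod_nbij' Fin.rev Fin.rev ?_ ?_ ?_ ?_ ?_
    · intro a ha
      have : a ≠ l.rev := (Finset.mem_erase.1 ha).1
      simpa [Fin.rev_eq_iff] using this
    · intro a ha
      have : a ≠ l := (Finset.mem_erase.1 ha).1
      simpa using this
    · simp
    · simp
    · intro a _
      rw [level_rev, ← neg_div_neg_eq]
      congr 1 <;> ring

theorem succ_mul_weight_single {n : ℕ} (q : ℝ) (m : ℕ) (l : Fin (n + 1)) :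
    ((m : ℝ) + 1) * weight (n + 1) q (Pi.single l (-((m : ℝ) + 1))) =
      q ^ (((m : ℝ) + 1) ^ 2 + (m + 1) * n - 2 * (m + 1) * ((l : ℕ) : ℝ)) *
        hyperCoeff n m l := by
  rw [← succ_mul_prod_fin_erase, weight_single, mul_left_comm]
  congr 1
  · congr 1
    rw [level]; push_cast; ring
  · congr 1
    refine Finset.prod_congr rfl fun v _ => ?_
    rw [level, level, ← neg_div_neg_eq]
    congr 1 <;> ring

theorem integrableOn_mul_exp_neg {c : ℝ} (hc : 0 < c) :
    IntegrableOn (fun s : ℝ => s * Real.exp (-(c * s))) (Set.Ioi 0) := by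
  have h := integrableOn_rpow_mul_exp_neg_mul_rpow (p := 1) (s := 1) (b := c) (by norm_num)
    one_pos hc
  simpa using h

theorem integral_mul_exp_neg {c : ℝ} (hc : 0 < c) :
    ∫ s in Set.Ioi (0 : ℝ), s * Real.exp (-(c * s)) = 1 / c ^ 2 := by
  have h := Real.integral_rpow_mul_exp_neg_mul_Ioi (a := 2) (r := c) (by norm_num) hc
  norm_num at h
  rw [h]
  norm_num

/-- Each product of terms integrates to 1/c² with c = n + m + 1 - u - v. As u ≤ n, c is positive
once v ≤ m; when v > m the coefficient vanishes, so no convergence is needed. -/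
theorem integral_mul_exp_mul_sq (n m : ℕ) (B : ℕ → ℝ) (hB : ∀ u, m < u → B u = 0) :
    IntegrableOn (fun s : ℝ => s * Real.exp (-(s * ((n : ℝ) + m + 1))) *
      (∑ u ∈ Finset.range (n + 1), B u * Real.exp s ^ u) ^ 2) (Set.Ioi 0) ∧
    ∫ s in Set.Ioi (0 : ℝ), s * Real.exp (-(s * ((n : ℝ) + m + 1))) *
      (∑ u ∈ Finset.range (n + 1), B u * Real.exp s ^ u) ^ 2 =
      ∑ u ∈ Finset.range (n + 1), ∑ v ∈ Finset.range (n + 1),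
        B u * B v / ((n : ℝ) + m + 1 - u - v) ^ 2 := by
  have e : ∀ s : ℝ, s * Real.exp (-(s * ((n : ℝ) + m + 1))) *
      (∑ u ∈ Finset.range (n + 1), B u * Real.exp s ^ u) ^ 2 =
      ∑ u ∈ Finset.range (n + 1), ∑ v ∈ Finset.range (n + 1),
        B u * B v * (s * Real.exp (-(((n : ℝ) + m + 1 - u - v) * s))) := by
    intro s
    rw [sq, Finset.sum_mul_sum, Finset.mul_sum]
    refine Finset.sum_congr rfl fun u _ => ?_
    rw [Finset.mul_sum]
    refine Finset.sum_congr rfl fun v _ => ?_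
    have : Real.exp (-(((n : ℝ) + m + 1 - u - v) * s)) =
        Real.exp (-(s * ((n : ℝ) + m + 1))) * (Real.exp s ^ u * Real.exp s ^ v) := by
      rw [← Real.exp_nat_mul, ← Real.exp_nat_mul, ← Real.exp_add, ← Real.exp_add]
      congr 1; ring
    rw [this]; ring
  have hterm : ∀ u ∈ Finset.range (n + 1), ∀ v ∈ Finset.range (n + 1),
      IntegrableOn (fun s : ℝ => B u * B v *
        (s * Real.exp (-(((n : ℝ) + m + 1 - u - v) * s)))) (Set.Ioi 0) ∧
      ∫ s in Set.Ioi (0 : ℝ), B u * B v * (s * Real.exp (-(((n : ℝ) + m + 1 - u - v) * s))) =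
        B u * B v / ((n : ℝ) + m + 1 - u - v) ^ 2 := by
    intro u hu v _
    have hu' : (u : ℝ) ≤ n := by
      exact_mod_cast Nat.lt_succ_iff.1 (Finset.mem_range.1 hu)
    rcases lt_or_ge m v with h | h
    · simp [hB v h]
    · have hv' : (v : ℝ) ≤ m := by exact_mod_cast h
      have hc : 0 < (n : ℝ) + m + 1 - u - v := by linarith
      refine ⟨(integrableOn_mul_exp_neg hc).const_mul _, ?_⟩
      rw [integral_const_mul, integral_mul_exp_neg hc, mul_one_div]
  simp_rw [e]
  refine ⟨integrable_finsetSum _ fun u hu => integrable_finsetSum _ fun v hv =>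
    (hterm u hu v hv).1, ?_⟩
  rw [integral_finsetSum _ fun u hu => integrable_finsetSum _ fun v hv => (hterm u hu v hv).1]
  refine Finset.sum_congr rfl fun u hu => ?_
  rw [integral_finsetSum _ fun v hv => (hterm u hu v hv).1]
  exact Finset.sum_congr rfl fun v hv => (hterm u hu v hv).2

theorem formFactor_eq_sum_hyperCoeff (n m : ℕ) {t : ℝ} (ht : 0 ≤ t) :
    formFactor (n + 1) ((m + 1 : ℕ) : ℤ) t = ((((min (m + 1) (n + 1) : ℕ) : ℝ) -
      nome (n + 1) t ^ (2 * ((m : ℝ) + 1) ^ 2 + 2 * (m + 1) * n) *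
      ∑ u ∈ Finset.range (n + 1), ∑ v ∈ Finset.range (n + 1),
        (hyperCoeff n m u * (nome (n + 1) t ^ (-2 * ((m + 1 : ℕ) : ℤ))) ^ u) *
        (hyperCoeff n m v * (nome (n + 1) t ^ (-2 * ((m + 1 : ℕ) : ℤ))) ^ v) /
        ((n : ℝ) + m + 1 - u - v) ^ 2 : ℝ) : ℂ) := by
  have hq := nome_pos (n + 1) t
  set q := nome (n + 1) t with hqdef
  have h := formFactor_eq_sub_sum (N := n + 1) (k := m + 1) (by omega) (by omega) ht
  rw [h, ← hqdef]
  congr 2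
  -- Only the index of the forward shift is reversed; the difference of levels in the denominator
  -- thereby becomes minus their sum.
  rw [← Equiv.sum_comp Fin.revPerm, Finset.mul_sum, Finset.mul_sum,
    ← Fin.sum_univ_eq_sum_range (fun u => _ * _)]
  refine Finset.sum_congr rfl fun u _ => ?_
  rw [← Fin.sum_univ_eq_sum_range (fun v => _ / _), Finset.mul_sum, Finset.mul_sum]
  refine Finset.sum_congr rfl fun v _ => ?_
  rw [Fin.revPerm_apply, weight_single_rev, level_rev]
  have hu := succ_mul_weight_single q m u
  have hv := succ_mul_weight_single q m v
  have hpow : ∀ l : ℕ, q ^ (((m : ℝ) + 1) ^ 2 + (m + 1) * n - 2 * (m + 1) * (l : ℝ)) =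
      q ^ (((m : ℝ) + 1) ^ 2 + (m + 1) * n) * (q ^ (-2 * ((m + 1 : ℕ) : ℤ))) ^ l := by
    intro l
    rw [← Real.rpow_intCast, ← Real.rpow_natCast _ l, ← Real.rpow_mul hq.le, ← Real.rpow_add hq]
    congr 1
    push_cast; ring
  have hpow2 : q ^ (2 * ((m : ℝ) + 1) ^ 2 + 2 * (m + 1) * n) =
      q ^ (((m : ℝ) + 1) ^ 2 + (m + 1) * n) * q ^ (((m : ℝ) + 1) ^ 2 + (m + 1) * n) := by
    rw [← Real.rpow_add hq]
    congr 1; ring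
  have hden : -level (n + 1) u - level (n + 1) v + ((m + 1 : ℕ) : ℝ) =
      (n : ℝ) + m + 1 - (u : ℕ) - (v : ℕ) := by
    rw [level, level]; push_cast; ring
  rw [hpow] at hu hv
  rw [hden, hpow2, mul_div_assoc', mul_div_assoc']
  congr 1
  generalize q ^ (-2 * ((m + 1 : ℕ) : ℤ)) = z at hu hv ⊢
  push_cast
  linear_combination ((m : ℝ) + 1) * weight (n + 1) q (Pi.single v (-((m : ℝ) + 1))) * hu +
    q ^ (((m : ℝ) + 1) ^ 2 + (m + 1) * n) * z ^ (u : ℕ) *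
      hyperCoeff n m u * hv

/-- The form factor as an integral of the square of any multiple of the hypergeometric sum. -/
theorem formFactor_eq_sub_integral (n m : ℕ) {t : ℝ} (ht : 0 ≤ t) {C : ℝ} (hC : C ≠ 0) (g : ℝ → ℝ)
    (hg : ∀ s, C * g s = ∑ u ∈ Finset.range (n + 1), hyperCoeff n m u *
      (nome (n + 1) t ^ (-2 * ((m + 1 : ℕ) : ℤ)) * Real.exp s) ^ u) :
    IntegrableOn (fun s : ℝ => s * Real.exp (-(s * (((n + 1 : ℕ) : ℝ) + ((m + 1 : ℕ) : ℝ) - 1))) *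
      g s ^ 2) (Set.Ioi 0) ∧
    formFactor (n + 1) ((m + 1 : ℕ) : ℤ) t = ((((min (m + 1) (n + 1) : ℕ) : ℝ) -
      nome (n + 1) t ^ (2 * ((m + 1 : ℕ) : ℤ) ^ 2 +
        2 * ((m + 1 : ℕ) : ℤ) * (((n + 1 : ℕ) : ℤ) - 1)) * C ^ 2 *
      ∫ s in Set.Ioi (0 : ℝ),
        s * Real.exp (-(s * (((n + 1 : ℕ) : ℝ) + ((m + 1 : ℕ) : ℝ) - 1))) * g s ^ 2 : ℝ) : ℂ) := by
  obtain ⟨hi, he⟩ := integral_mul_exp_mul_sq n m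
    (fun u => hyperCoeff n m u * (nome (n + 1) t ^ (-2 * ((m + 1 : ℕ) : ℤ))) ^ u)
    (fun u hu => by rw [hyperCoeff_eq_zero_right hu, zero_mul])
  have e : (fun s : ℝ => s * Real.exp (-(s * (((n + 1 : ℕ) : ℝ) + ((m + 1 : ℕ) : ℝ) - 1))) *
      g s ^ 2) = fun s => (C ^ 2)⁻¹ * (s * Real.exp (-(s * ((n : ℝ) + m + 1))) *
      (∑ u ∈ Finset.range (n + 1), hyperCoeff n m u *
        (nome (n + 1) t ^ (-2 * ((m + 1 : ℕ) : ℤ))) ^ u * Real.exp s ^ u) ^ 2) := by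
    ext s
    have h : C * g s = ∑ u ∈ Finset.range (n + 1), hyperCoeff n m u *
        (nome (n + 1) t ^ (-2 * ((m + 1 : ℕ) : ℤ))) ^ u * Real.exp s ^ u := by
      rw [hg]
      exact Finset.sum_congr rfl fun u _ => by rw [mul_pow]; ring
    rw [← h, show ((n + 1 : ℕ) : ℝ) + ((m + 1 : ℕ) : ℝ) - 1 = (n : ℝ) + m + 1 by push_cast; ring]
    field_simp
  refine ⟨e ▸ hi.const_mul _, ?_⟩
  rw [e, integral_const_mul, he, mul_assoc _ (C ^ 2), mul_inv_cancel_left₀ (pow_ne_zero 2 hC),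
    formFactor_eq_sum_hyperCoeff n m ht, show 2 * ((m : ℝ) + 1) ^ 2 + 2 * (m + 1) * n =
      ((2 * ((m + 1 : ℕ) : ℤ) ^ 2 + 2 * ((m + 1 : ℕ) : ℤ) * (((n + 1 : ℕ) : ℤ) - 1) : ℤ) : ℝ) by
        push_cast; ring, Real.rpow_intCast]

/-! ### The limit of large matrices -/

theorem integrableOn_polynomial_mul_exp_neg (p : Polynomial ℝ) {c : ℝ} (hc : 0 < c) :
    IntegrableOn (fun s : ℝ => p.eval s * Real.exp (-(c * s))) (Set.Ioi 0) := by
  simp_rw [Polynomial.eval_eq_sum_range, Finset.sum_mul]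
  refine integrable_finsetSum _ fun i _ => ?_
  have h := integrableOn_rpow_mul_exp_neg_mul_rpow (p := 1) (s := i) (b := c)
    (by linarith [(Nat.cast_nonneg i : (0 : ℝ) ≤ i)]) one_pos hc
  have := Integrable.const_mul h (p.coeff i)
  simpa [mul_assoc] using this

/-- The polynomial `₁F₁(-m; 2; x)`. -/
noncomputable def kummerPoly (m : ℕ) : Polynomial ℝ :=
  ∑ j ∈ Finset.range (m + 1),
    Polynomial.monomial j ((-1) ^ j * ((m.descFactorial j : ℝ) / (j.factorial * (j + 1).factorial)))

theorem kummerPoly_eval (m : ℕ) (x : ℝ) : (kummerPoly m).eval x = ∑ j ∈ Finset.range (m + 1),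
    (m.descFactorial j : ℝ) / (j.factorial * (j + 1).factorial) * (-x) ^ j := by
  rw [kummerPoly, Polynomial.eval_finsetSum]
  refine Finset.sum_congr rfl fun j _ => ?_
  rw [Polynomial.eval_monomial, neg_pow x]; ring

theorem kummer_eq_eval (m : ℕ) (x : ℝ) : kummer (-(m : ℝ)) 2 x = (kummerPoly m).eval x := by
  rw [kummer, kummerPoly_eval, tsum_eq_sum (s := Finset.range (m + 1))]
  · refine Finset.sum_congr rfl fun j _ => ?_
    rw [ascPochhammer_eval_neg_nat, ascPochhammer_eval_two, neg_pow x]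
    ring
  · intro j hj
    rw [ascPochhammer_eval_neg_nat, Nat.descFactorial_of_lt (by simpa using hj)]
    simp

/-- The factor m + 1 = k is what absorbs the k² of the first limit form. -/
theorem laguerre_one_eq_eval (m : ℕ) (x : ℝ) :
    laguerre m 1 x = ((m : ℝ) + 1) * (kummerPoly m).eval x := by
  rw [laguerre, kummerPoly_eval, Finset.mul_sum]
  refine Finset.sum_congr rfl fun i hi => ?_
  have hi' : i ≤ m := by simpa [Nat.lt_succ_iff] using hi
  have h := Nat.factorial_mul_ascFactorial (i + 1) (m - i)
  rw [show i + 1 + (m - i) = m + 1 by omega, Nat.factorial_succ m,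
    ← Nat.factorial_mul_descFactorial hi'] at h
  have h' : (((i + 1).factorial * (i + 1 + 1).ascFactorial (m - i) : ℕ) : ℝ) =
    (((m + 1) * ((m - i).factorial * m.descFactorial i) : ℕ) : ℝ) := by rw [h]
  rw [show (1 : ℝ) + i + 1 = ((i + 1 + 1 : ℕ) : ℝ) by push_cast; ring, ← Nat.cast_ascFactorial,
    neg_pow x]
  rw [Nat.cast_mul, Nat.cast_mul, Nat.cast_mul] at h'
  push_cast at h' ⊢
  field_simp
  linear_combination x ^ i * h'

/-- By symmetry the sum is cut at m instead of n, so the number of terms stays fixed as n grows. -/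
theorem ordinaryHypergeometric_neg_nat_two (n m : ℕ) (z : ℝ) :
    ordinaryHypergeometric (-(n : ℝ)) (-(m : ℝ)) 2 z = ∑ j ∈ Finset.range (m + 1),
      (m.descFactorial j : ℝ) / (j.factorial * (j + 1).factorial) *
        ((n.descFactorial j : ℝ) * z ^ j) := by
  have h : ordinaryHypergeometric (-(n : ℝ)) (-(m : ℝ)) (2 : ℝ) z =
      ordinaryHypergeometric (-(m : ℝ)) (-(n : ℝ)) (2 : ℝ) z := by
    rw [ordinaryHypergeometric, ordinaryHypergeometric, ordinaryHypergeometricSeries_symm]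
  rw [h, ordinaryHypergeometric_neg_nat]
  refine Finset.sum_congr rfl fun j _ => ?_
  rw [ascPochhammer_eval_two]
  field_simp

theorem tendsto_descFactorial_mul_one_sub_exp (j : ℕ) (y : ℝ) :
    Tendsto (fun n : ℕ => (n.descFactorial j : ℝ) * (1 - Real.exp (y / ((n : ℝ) + 1))) ^ j)
      atTop (𝓝 ((-y) ^ j)) := by
  have hn : Tendsto (fun n : ℕ => ((n : ℝ) + 1)⁻¹) atTop (𝓝 0) := by
    simpa using tendsto_one_div_add_atTop_nhds_zero_nat (𝕜 := ℝ)
  -- This is minus the slope of x ↦ e^(yx) at 0.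
  have h1 : Tendsto (fun n : ℕ => ((n : ℝ) + 1) * (1 - Real.exp (y / ((n : ℝ) + 1)))) atTop
      (𝓝 (-y)) := by
    have hd : HasDerivAt (fun x : ℝ => Real.exp (y * x)) y 0 := by
      have := ((hasDerivAt_id (0 : ℝ)).const_mul y).exp
      simpa using this
    have hs := hd.tendsto_slope
    have h2 : Tendsto (fun n : ℕ => ((n : ℝ) + 1)⁻¹) atTop (𝓝[≠] 0) :=
      tendsto_nhdsWithin_iff.2 ⟨hn, Eventually.of_forall fun n => by
        have : (n : ℝ) + 1 ≠ 0 := by positivity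
        simpa using this⟩
    refine ((hs.comp h2).neg).congr fun n => ?_
    simp [slope_def_field, div_eq_mul_inv]
    ring
  induction j with
  | zero => simp
  | succ j ih =>
    have h3 : Tendsto (fun n : ℕ => (((n - j : ℕ) : ℝ)) * ((n : ℝ) + 1)⁻¹) atTop (𝓝 1) := by
      have : Tendsto (fun n : ℕ => 1 - ((j : ℝ) + 1) * ((n : ℝ) + 1)⁻¹) atTop (𝓝 (1 - (j + 1) * 0)) :=
        tendsto_const_nhds.sub (hn.const_mul _)
      rw [mul_zero, sub_zero] at this
      refine this.congr' ?_
      filter_upwards [eventually_ge_atTop j] with n hn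
      rw [Nat.cast_sub hn]
      have : (n : ℝ) + 1 ≠ 0 := by positivity
      field_simp
      ring
    have h4 := (ih.mul h3).mul h1
    rw [mul_one, ← pow_succ] at h4
    refine h4.congr fun n => ?_
    rw [Nat.descFactorial_succ]
    have : (n : ℝ) + 1 ≠ 0 := by positivity
    push_cast
    field_simp
    ring

theorem abs_descFactorial_mul_one_sub_exp_le (n j : ℕ) {y : ℝ} (hy : 0 ≤ y) :
    |(n.descFactorial j : ℝ) * (1 - Real.exp (y / ((n : ℝ) + 1))) ^ j| ≤
      y ^ j * Real.exp (y / ((n : ℝ) + 1)) ^ j := by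
  have hn : (0 : ℝ) < (n : ℝ) + 1 := by positivity
  set x := y / ((n : ℝ) + 1) with hx
  have hx0 : 0 ≤ x := by positivity
  -- Multiply 1 - x ≤ e^(-x) by e^x.
  have h1 : |1 - Real.exp x| ≤ x * Real.exp x := by
    rw [abs_sub_comm, abs_of_nonneg (by linarith [Real.one_le_exp hx0])]
    have := Real.add_one_le_exp (-x)
    have h2 : Real.exp (-x) * Real.exp x = 1 := by rw [← Real.exp_add]; simp
    nlinarith [Real.exp_pos x]
  have h2 : (n.descFactorial j : ℝ) ≤ ((n : ℝ) + 1) ^ j := by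
    calc (n.descFactorial j : ℝ) ≤ (n : ℝ) ^ j := by exact_mod_cast Nat.descFactorial_le_pow n j
      _ ≤ _ := by gcongr; linarith
  rw [abs_mul, abs_pow, Nat.abs_cast]
  calc _ ≤ ((n : ℝ) + 1) ^ j * (x * Real.exp x) ^ j := by gcongr
    _ = _ := by
      rw [← mul_pow, ← mul_assoc, hx, mul_div_cancel₀ _ hn.ne', mul_pow]

/-- The integrand after rescaling the variable by the size of the matrix. -/
noncomputable def scaledIntegrand (n m : ℕ) (a s : ℝ) : ℝ :=
  s * Real.exp (-(s * ((n : ℝ) + m + 1) / ((n : ℝ) + 1))) *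
    ordinaryHypergeometric (-(n : ℝ)) (-(m : ℝ)) (2 : ℝ)
      (1 - Real.exp ((a + s) / ((n : ℝ) + 1))) ^ 2

theorem tendsto_hypergeometric_kummerPoly (m : ℕ) (y : ℝ) :
    Tendsto (fun n : ℕ => ordinaryHypergeometric (-(n : ℝ)) (-(m : ℝ)) (2 : ℝ)
      (1 - Real.exp (y / ((n : ℝ) + 1)))) atTop (𝓝 ((kummerPoly m).eval y)) := by
  simp_rw [ordinaryHypergeometric_neg_nat_two, kummerPoly_eval]
  exact tendsto_finsetSum _ fun j _ => (tendsto_descFactorial_mul_one_sub_exp j y).const_mul _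

theorem tendsto_scaledIntegrand (m : ℕ) (a s : ℝ) :
    Tendsto (fun n : ℕ => scaledIntegrand n m a s) atTop
      (𝓝 (s * Real.exp (-s) * (kummerPoly m).eval (a + s) ^ 2)) := by
  have hn : Tendsto (fun n : ℕ => ((n : ℝ) + 1)⁻¹) atTop (𝓝 0) := by
    simpa using tendsto_one_div_add_atTop_nhds_zero_nat (𝕜 := ℝ)
  have h1 : Tendsto (fun n : ℕ => -(s * ((n : ℝ) + m + 1) / ((n : ℝ) + 1))) atTop (𝓝 (-s)) := by
    have : Tendsto (fun n : ℕ => -s - s * m * ((n : ℝ) + 1)⁻¹) atTop (𝓝 (-s - s * m * 0)) :=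
      tendsto_const_nhds.sub (hn.const_mul _)
    rw [mul_zero, sub_zero] at this
    refine this.congr fun n => ?_
    have : (n : ℝ) + 1 ≠ 0 := by positivity
    field_simp
    ring
  exact (((Real.continuous_exp.tendsto _).comp h1).const_mul s).mul
    ((tendsto_hypergeometric_kummerPoly m (a + s)).pow 2)

/-- At -y all terms of `kummerPoly` are nonnegative, so it bounds the sum of absolute values. -/
theorem abs_hypergeometric_le (n m : ℕ) {y : ℝ} (hy : 0 ≤ y) :
    |ordinaryHypergeometric (-(n : ℝ)) (-(m : ℝ)) (2 : ℝ) (1 - Real.exp (y / ((n : ℝ) + 1)))| ≤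
      (kummerPoly m).eval (-y) * Real.exp (y / ((n : ℝ) + 1)) ^ m := by
  rw [ordinaryHypergeometric_neg_nat_two, kummerPoly_eval, Finset.sum_mul]
  refine (Finset.abs_sum_le_sum_abs _ _).trans (Finset.sum_le_sum fun j hj => ?_)
  have hj' : j ≤ m := by simpa [Nat.lt_succ_iff] using hj
  rw [abs_mul, abs_of_nonneg (by positivity), mul_assoc, neg_neg]
  gcongr
  refine (abs_descFactorial_mul_one_sub_exp_le n j hy).trans ?_
  gcongr
  exact Real.one_le_exp (by positivity)

/-- The exponents combine to -s + (ms + 2ma)/(n + 1), which is at most a - s/2 once 2m ≤ n + 1: a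
bound uniform in n, of polynomial times exponential type. -/
theorem abs_scaledIntegrand_le {n m : ℕ} (hnm : 2 * m ≤ n + 1) {a s : ℝ} (ha : 0 ≤ a) (hs : 0 ≤ s) :
    |scaledIntegrand n m a s| ≤
      Real.exp a * (s * (kummerPoly m).eval (-(a + s)) ^ 2 * Real.exp (-(1 / 2 * s))) := by
  have hn : (0 : ℝ) < (n : ℝ) + 1 := by positivity
  have h := abs_hypergeometric_le n m (add_nonneg ha hs)
  have hsq := pow_le_pow_left₀ (abs_nonneg _) h 2
  rw [sq_abs] at hsq
  rw [scaledIntegrand, abs_of_nonneg (by positivity)]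
  calc _ ≤ s * Real.exp (-(s * ((n : ℝ) + m + 1) / ((n : ℝ) + 1))) *
        ((kummerPoly m).eval (-(a + s)) * Real.exp ((a + s) / ((n : ℝ) + 1)) ^ m) ^ 2 := by gcongr
    _ = s * (kummerPoly m).eval (-(a + s)) ^ 2 *
        Real.exp (-(s * ((n : ℝ) + m + 1) / ((n : ℝ) + 1)) + 2 * m * ((a + s) / ((n : ℝ) + 1))) := by
      rw [Real.exp_add, ← Real.exp_nat_mul, mul_pow, ← Real.exp_nat_mul]
      push_cast
      ring_nf
    _ ≤ s * (kummerPoly m).eval (-(a + s)) ^ 2 * Real.exp (a + -(1 / 2 * s)) := by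
      refine mul_le_mul_of_nonneg_left (Real.exp_le_exp.2 ?_) (by positivity)
      have hm : 2 * (m : ℝ) ≤ (n : ℝ) + 1 := by exact_mod_cast hnm
      have e : -(s * ((n : ℝ) + m + 1) / ((n : ℝ) + 1)) + 2 * m * ((a + s) / ((n : ℝ) + 1)) =
          (-(s * ((n : ℝ) + m + 1)) + 2 * m * (a + s)) / ((n : ℝ) + 1) := by ring
      rw [e, div_le_iff₀ hn]
      nlinarith
    _ = _ := by rw [Real.exp_add]; ring

theorem continuous_scaledIntegrand (n m : ℕ) (a : ℝ) : Continuous (scaledIntegrand n m a) := by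
  unfold scaledIntegrand
  simp_rw [ordinaryHypergeometric_neg_nat_two]
  fun_prop

theorem tendsto_integral_scaledIntegrand (m : ℕ) {a : ℝ} (ha : 0 ≤ a) :
    Tendsto (fun n : ℕ => ∫ s in Set.Ioi (0 : ℝ), scaledIntegrand n m a s) atTop
      (𝓝 (∫ s in Set.Ioi (0 : ℝ), s * Real.exp (-s) * (kummerPoly m).eval (a + s) ^ 2)) := by
  refine tendsto_integral_filter_of_dominated_convergence
    (fun s => Real.exp a * (s * (kummerPoly m).eval (-(a + s)) ^ 2 * Real.exp (-(1 / 2 * s))))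
    (Eventually.of_forall fun n => (continuous_scaledIntegrand n m a).aestronglyMeasurable) ?_ ?_
    (Eventually.of_forall fun s => tendsto_scaledIntegrand m a s)
  · filter_upwards [eventually_ge_atTop (2 * m)] with n hn
    refine (ae_restrict_iff' measurableSet_Ioi).2 (Eventually.of_forall fun s hs => ?_)
    exact abs_scaledIntegrand_le (by omega) ha (le_of_lt hs)
  · refine Integrable.const_mul ?_ _
    have := integrableOn_polynomial_mul_exp_neg
      (Polynomial.X * ((kummerPoly m).comp (-(Polynomial.C a + Polynomial.X))) ^ 2)
      (c := 1 / 2) (by norm_num)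
    simpa [IntegrableOn] using this

theorem integrableOn_kummerPoly (m : ℕ) (a : ℝ) :
    IntegrableOn (fun s : ℝ => s * Real.exp (-s) * (kummerPoly m).eval (a + s) ^ 2)
      (Set.Ioi 0) := by
  have := integrableOn_polynomial_mul_exp_neg
    (Polynomial.X * ((kummerPoly m).comp (Polynomial.C a + Polynomial.X)) ^ 2) one_pos
  refine this.congr_fun (fun s _ => ?_) measurableSet_Ioi
  simp
  ring

theorem formFactor_eq_scaled (n m : ℕ) {t : ℝ} (ht : 0 ≤ t) :
    formFactor (n + 1) ((m + 1 : ℕ) : ℤ) t = ((((min (m + 1) (n + 1) : ℕ) : ℝ) -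
      Real.exp (-(t * ((m + 1) * (m + 1 + n) / ((n : ℝ) + 1)))) * ((m : ℝ) + 1) ^ 2 *
      ∫ s in Set.Ioi (0 : ℝ), scaledIntegrand n m (((m + 1 : ℕ) : ℝ) * t) s : ℝ) : ℂ) := by
  have hn : (0 : ℝ) < (n : ℝ) + 1 := by positivity
  have hC : ((m : ℝ) + 1) * ((n : ℝ) + 1) ≠ 0 := by positivity
  obtain ⟨_, h⟩ := formFactor_eq_sub_integral n m ht hC (fun s =>
    ordinaryHypergeometric (-(n : ℝ)) (-(m : ℝ)) (2 : ℝ)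
      (1 - nome (n + 1) t ^ (-2 * ((m + 1 : ℕ) : ℤ)) * Real.exp s))
    (fun s => succ_mul_succ_mul_hypergeometric_two n m _)
  rw [h]
  have hzpow : ∀ z : ℤ, nome (n + 1) t ^ z = Real.exp (-t / (2 * ((n : ℝ) + 1)) * z) := by
    intro z
    rw [nome, ← Real.rpow_intCast, ← Real.exp_mul]
    push_cast; rfl
  have hcv := integral_comp_mul_left_Ioi (fun s : ℝ =>
    s * Real.exp (-(s * (((n + 1 : ℕ) : ℝ) + ((m + 1 : ℕ) : ℝ) - 1))) *
      ordinaryHypergeometric (-(n : ℝ)) (-(m : ℝ)) (2 : ℝ)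
      (1 - nome (n + 1) t ^ (-2 * ((m + 1 : ℕ) : ℤ)) * Real.exp s) ^ 2) 0 (inv_pos.2 hn)
  rw [mul_zero, inv_inv, smul_eq_mul] at hcv
  -- After substituting s/N for s, the factor s and the differential each give 1/N, absorbing the N²
  -- of the prefactor, and q^(-2k) e^(s/N) = e^((kt+s)/N).
  have hint : ∫ s in Set.Ioi (0 : ℝ), scaledIntegrand n m (((m + 1 : ℕ) : ℝ) * t) s =
      ((n : ℝ) + 1) * (((n : ℝ) + 1) * ∫ s in Set.Ioi (0 : ℝ),
        s * Real.exp (-(s * (((n + 1 : ℕ) : ℝ) + ((m + 1 : ℕ) : ℝ) - 1))) *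
        ordinaryHypergeometric (-(n : ℝ)) (-(m : ℝ)) (2 : ℝ)
        (1 - nome (n + 1) t ^ (-2 * ((m + 1 : ℕ) : ℤ)) * Real.exp s) ^ 2) := by
    rw [← hcv, ← integral_const_mul]
    refine integral_congr_ae (Eventually.of_forall fun s => ?_)
    simp only [scaledIntegrand]
    rw [hzpow, ← Real.exp_add]
    have e1 : -t / (2 * ((n : ℝ) + 1)) * ((-2 * ((m + 1 : ℕ) : ℤ) : ℤ) : ℝ) + ((n : ℝ) + 1)⁻¹ * s =
        (((m + 1 : ℕ) : ℝ) * t + s) / ((n : ℝ) + 1) := by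
      push_cast; field_simp
    have e2 : -(((n : ℝ) + 1)⁻¹ * s * (((n + 1 : ℕ) : ℝ) + ((m + 1 : ℕ) : ℝ) - 1)) =
        -(s * ((n : ℝ) + m + 1) / ((n : ℝ) + 1)) := by
      push_cast; field_simp; ring
    rw [e1, e2]
    field_simp
  have hQ : nome (n + 1) t ^ (2 * ((m + 1 : ℕ) : ℤ) ^ 2 +
        2 * ((m + 1 : ℕ) : ℤ) * (((n + 1 : ℕ) : ℤ) - 1)) =
      Real.exp (-(t * ((m + 1) * (m + 1 + n) / ((n : ℝ) + 1)))) := by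
    rw [hzpow]
    congr 1
    push_cast; field_simp; ring
  rw [hint, hQ]
  congr 2
  ring

theorem tendsto_formFactor (m : ℕ) {t : ℝ} (ht : 0 ≤ t) :
    Tendsto (fun N : ℕ => formFactor N ((m + 1 : ℕ) : ℤ) t) atTop
      (𝓝 ((((m + 1 : ℕ) : ℝ) - Real.exp (-(t * ((m + 1 : ℕ) : ℝ))) * ((m : ℝ) + 1) ^ 2 *
        ∫ s in Set.Ioi (0 : ℝ), s * Real.exp (-s) *
          (kummerPoly m).eval (((m + 1 : ℕ) : ℝ) * t + s) ^ 2 : ℝ) : ℂ)) := by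
  rw [← tendsto_add_atTop_iff_nat 1]
  simp_rw [formFactor_eq_scaled _ m ht]
  refine (Complex.continuous_ofReal.tendsto _).comp ?_
  have hn : Tendsto (fun n : ℕ => ((n : ℝ) + 1)⁻¹) atTop (𝓝 0) := by
    simpa using tendsto_one_div_add_atTop_nhds_zero_nat (𝕜 := ℝ)
  have h1 : Tendsto (fun n : ℕ => ((min (m + 1) (n + 1) : ℕ) : ℝ)) atTop (𝓝 ((m + 1 : ℕ) : ℝ)) := by
    refine tendsto_const_nhds.congr' ?_
    filter_upwards [eventually_ge_atTop m] with n hn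
    rw [min_eq_left (by omega)]
  have h2 : Tendsto (fun n : ℕ => -(t * (((m : ℝ) + 1) * (m + 1 + n) / ((n : ℝ) + 1)))) atTop
      (𝓝 (-(t * ((m + 1 : ℕ) : ℝ)))) := by
    have : Tendsto (fun n : ℕ => -(t * ((m + 1 : ℕ) : ℝ)) -
        t * ((m + 1) * m) * ((n : ℝ) + 1)⁻¹) atTop
        (𝓝 (-(t * ((m + 1 : ℕ) : ℝ)) - t * ((m + 1) * m) * 0)) :=
      tendsto_const_nhds.sub (hn.const_mul _)
    rw [mul_zero, sub_zero] at this
    refine this.congr fun n => ?_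
    have : (n : ℝ) + 1 ≠ 0 := by positivity
    push_cast
    field_simp
    ring
  exact h1.sub ((((Real.continuous_exp.tendsto _).comp h2).mul_const _).mul
    (tendsto_integral_scaledIntegrand m (by positivity)))

end DysonBM

/-! ### The finite-size formulas and their limit -/

theorem proposition5p2 :
    -- the two integral forms at finite `N` (the integrals converge)
    (∀ (N k : ℕ) (t : ℝ), 1 ≤ N → 1 ≤ k → 0 ≤ t →
      MeasureTheory.IntegrableOn (fun s : ℝ =>
        s * Real.exp (-(s * ((N : ℝ) + k - 1))) *
          (ordinaryHypergeometric (1 - (N : ℝ)) (1 - (k : ℝ)) (-((k : ℝ) - 1 + N))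
            (DysonBM.nome N t ^ (-2 * (k : ℤ)) * Real.exp s)) ^ 2) (Set.Ioi 0) ∧
      DysonBM.formFactor N k t =
        (((min k N : ℕ) : ℝ) -
          DysonBM.nome N t ^ (2 * (k : ℤ) ^ 2 + 2 * (k : ℤ) * ((N : ℤ) - 1)) *
          (((N - 1 + k).factorial : ℝ) / (((k - 1).factorial : ℝ) * ((N - 1).factorial : ℝ))) ^ 2 *
          ∫ s in Set.Ioi (0 : ℝ), s * Real.exp (-(s * ((N : ℝ) + k - 1))) *
            (ordinaryHypergeometric (1 - (N : ℝ)) (1 - (k : ℝ)) (-((k : ℝ) - 1 + N))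
              (DysonBM.nome N t ^ (-2 * (k : ℤ)) * Real.exp s)) ^ 2 : ℝ) ∧
      MeasureTheory.IntegrableOn (fun s : ℝ =>
        s * Real.exp (-(s * ((N : ℝ) + k - 1))) *
          (ordinaryHypergeometric (1 - (N : ℝ)) (1 - (k : ℝ)) (2 : ℝ)
            (1 - DysonBM.nome N t ^ (-2 * (k : ℤ)) * Real.exp s)) ^ 2) (Set.Ioi 0) ∧
      DysonBM.formFactor N k t =
        (((min k N : ℕ) : ℝ) -
          DysonBM.nome N t ^ (2 * (k : ℤ) ^ 2 + 2 * (k : ℤ) * ((N : ℤ) - 1)) *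
          ((k : ℝ) * N) ^ 2 *
          ∫ s in Set.Ioi (0 : ℝ), s * Real.exp (-(s * ((N : ℝ) + k - 1))) *
            (ordinaryHypergeometric (1 - (N : ℝ)) (1 - (k : ℝ)) (2 : ℝ)
              (1 - DysonBM.nome N t ^ (-2 * (k : ℤ)) * Real.exp s)) ^ 2 : ℝ)) ∧
    -- the limit `N → ∞` for fixed `k`, in two forms (the integrals converge)
    (∀ (k : ℕ) (t : ℝ), 1 ≤ k → 0 ≤ t →
      MeasureTheory.IntegrableOn (fun s : ℝ =>
        s * Real.exp (-s) * (DysonBM.kummer (1 - (k : ℝ)) 2 ((k : ℝ) * t + s)) ^ 2) (Set.Ioi 0) ∧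
      Filter.Tendsto (fun N : ℕ => DysonBM.formFactor N k t) Filter.atTop
        (nhds (((k : ℝ) - Real.exp (-(t * k)) * (k : ℝ) ^ 2 *
          ∫ s in Set.Ioi (0 : ℝ), s * Real.exp (-s) *
            (DysonBM.kummer (1 - (k : ℝ)) 2 ((k : ℝ) * t + s)) ^ 2 : ℝ) : ℂ)) ∧
      MeasureTheory.IntegrableOn (fun s : ℝ =>
        s * Real.exp (-s) * (DysonBM.laguerre (k - 1) 1 ((k : ℝ) * t + s)) ^ 2) (Set.Ioi 0) ∧
      Filter.Tendsto (fun N : ℕ => DysonBM.formFactor N k t) Filter.atTop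
        (nhds (((k : ℝ) - Real.exp (-(t * k)) *
          ∫ s in Set.Ioi (0 : ℝ), s * Real.exp (-s) *
            (DysonBM.laguerre (k - 1) 1 ((k : ℝ) * t + s)) ^ 2 : ℝ) : ℂ))) := by
  have hsub : ∀ m : ℕ, 1 - ((m + 1 : ℕ) : ℝ) = -(m : ℝ) := fun m => by push_cast; ring
  refine ⟨fun N k t hN hk ht => ?_, fun k t hk ht => ?_⟩
  · obtain ⟨n, rfl⟩ : ∃ n, N = n + 1 := ⟨N - 1, by omega⟩
    obtain ⟨m, rfl⟩ : ∃ m, k = m + 1 := ⟨k - 1, by omega⟩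
    rw [hsub, hsub, show -(((m + 1 : ℕ) : ℝ) - 1 + ((n + 1 : ℕ) : ℝ)) = -((n + m + 1 : ℕ) : ℝ) by
      push_cast; ring, show n + 1 - 1 + (m + 1) = n + m + 1 by omega, Nat.add_sub_cancel,
      Nat.add_sub_cancel]
    -- The two forms differ only in the constant by which the common polynomial is divided.
    have h1 := DysonBM.formFactor_eq_sub_integral n m ht
      (C := ((n + m + 1).factorial : ℝ) / ((m.factorial : ℝ) * (n.factorial : ℝ))) (by positivity) _
      fun s => DysonBM.factorial_mul_hypergeometric_neg n m _
    have h2 := DysonBM.formFactor_eq_sub_integral n m ht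
      (C := ((m + 1 : ℕ) : ℝ) * ((n + 1 : ℕ) : ℝ)) (by positivity) _
      fun s => by
        push_cast
        exact DysonBM.succ_mul_succ_mul_hypergeometric_two n m _
    exact ⟨h1.1, h1.2, h2.1, h2.2⟩
  · obtain ⟨m, rfl⟩ : ∃ m, k = m + 1 := ⟨k - 1, by omega⟩
    simp_rw [hsub, Nat.add_sub_cancel, DysonBM.kummer_eq_eval, DysonBM.laguerre_one_eq_eval]
    have hi := DysonBM.integrableOn_kummerPoly m (((m + 1 : ℕ) : ℝ) * t)
    have hl := DysonBM.tendsto_formFactor m ht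
    have e : ∀ s : ℝ, s * Real.exp (-s) * (((m : ℝ) + 1) *
        (DysonBM.kummerPoly m).eval (((m + 1 : ℕ) : ℝ) * t + s)) ^ 2 =
        ((m : ℝ) + 1) ^ 2 * (s * Real.exp (-s) *
          (DysonBM.kummerPoly m).eval (((m + 1 : ℕ) : ℝ) * t + s) ^ 2) := fun s => by ring
    simp_rw [e]
    refine ⟨hi, ?_, hi.const_mul _, ?_⟩
    · rw [← Nat.cast_succ] at hl
      exact hl
    · rw [MeasureTheory.integral_const_mul, ← mul_assoc]
      exact hl
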